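/- Let $\sigma$ be a killed subordinator, that is, a (real-valued, non-decreasing, right-continuous, $\sigma_0=0$) process with independent and stationary increments, killed at a lifetime $\zeta$ which is an independent exponential time of parameter $q>0$. Let $\phi(\lambda)=-\log \mathbb{E}\left[e^{-\lambda\sigma_1};\,1<\zeta\right]$, $\lambda\ge 0$, be its Laplace exponent and $V_\sigma(dy)=\mathbb{E}\left[\int_0^\zeta 1_{\{\sigma_t\in dy\}}\,dt\right]$ its potential measure. Then $\phi(0)V_\sigma(dy)$ is a probability measure, and there is exactly one probability law on $[0,\infty)$ whose entire moments are $\int x^n\rho(dx)=\prod_{k=1}^n\phi(k)$ for all integers $n\ge 0$; this law does not charge $0$. Let $R_\sigma$ be a random variable with this law (the residual exponential functional of $\sigma$), $G^{(0)}$ a random variable with law $\phi(0)V_\sigma(dy)$ and $\mathbf{e}_1$ a standard exponential random variable, with $\mathbf{e}_1$, $G^{(0)}$, $R_\sigma$ independent. (i) If $W$ is a $[0,\infty)$-valued random variable with a probability density $h_W$ that is completely monotone on $(0,\infty)$ and satisfies $$\mathbb{P}(W>t)=\int_t^\infty h_W(u)\,du=\int_{\mathbb{R}}h_W(te^{-a})\,V_\sigma(da)\qquad\text{for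 all } t>0,$$ then $W$ has the same law as $\mathbf{e}_1\,e^{G^{(0)}}/R_\sigma$. (ii) The exponential functional $\int_0^\infty e^{\sigma_s}\,ds$, understood as $\int_0^\zeta e^{\sigma_s}\,ds$ (that is, $e^{\sigma_s}:=0$ for $s\ge\zeta$), is almost surely finite and has the same law as $\mathbf{e}_1\,e^{G^{(0)}}/R_\sigma$. -/

import Mathlib

open MeasureTheory ProbabilityTheory Set
open scoped NNReal ENNReal

/-- A (real valued, unkilled) subordinator: a process with independent and stationary increments,
started from `0`, almost all of whose paths are non-decreasing and right-continuous (left limits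
are then automatic). -/
structure IsSubordinator {Ω : Type*} [MeasurableSpace Ω] (S : ℝ≥0 → Ω → ℝ) (P : Measure Ω) :
    Prop where
  measurable : ∀ t, Measurable (S t)
  start_zero : ∀ᵐ ω ∂P, S 0 ω = 0
  indep_increments : HasIndepIncrements S P
  stationary_increments : ∀ s t : ℝ≥0, IdentDistrib (fun ω => S (s + t) ω - S s ω) (S t) P P
  monotone_paths : ∀ᵐ ω ∂P, Monotone fun t => S t ω
  right_continuous : ∀ᵐ ω ∂P, ∀ t, ContinuousWithinAt (fun s => S s ω) (Ici t) t

/-- A killed subordinator with killing rate `q > 0`: a subordinator `S` together with a lifetime `ζ`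
that is exponential with parameter `q` and independent of the whole process `S`. The killed process
equals `S` on `[0, ζ)` and sits in the cemetery state from time `ζ` on. -/
structure IsKilledSubordinator {Ω : Type*} [MeasurableSpace Ω] (S : ℝ≥0 → Ω → ℝ) (ζ : Ω → ℝ)
    (q : ℝ) (P : Measure Ω) : Prop where
  isSubordinator : IsSubordinator S P
  rate_pos : 0 < q
  lifetime_measurable : Measurable ζ
  lifetime_law : HasLaw ζ (expMeasure q) P
  lifetime_indep : IndepFun (fun ω t => S t ω) ζ P

/-- The Laplace exponent `φ(l) = -log E[exp(-l σ₁); 1 < ζ]`. -/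
noncomputable def laplaceExponent {Ω : Type*} [MeasurableSpace Ω] (S : ℝ≥0 → Ω → ℝ) (ζ : Ω → ℝ)
    (P : Measure Ω) (l : ℝ) : ℝ :=
  -Real.log (∫ ω in {ω | 1 < ζ ω}, Real.exp (-l * S 1 ω) ∂P)

/-- The potential measure `V(A) = E[∫₀^ζ 1{σ_t ∈ A} dt]`: the image under `(ω, t) ↦ σ_t(ω)` of the
product of `P` and Lebesgue measure restricted to `{(ω, t) : 0 ≤ t < ζ(ω)}`. -/
noncomputable def potentialMeasure {Ω : Type*} [MeasurableSpace Ω] (S : ℝ≥0 → Ω → ℝ) (ζ : Ω → ℝ)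
    (P : Measure Ω) : Measure ℝ :=
  ((P.prod volume).restrict {p : Ω × ℝ | 0 ≤ p.2 ∧ p.2 < ζ p.1}).map
    fun p => S p.2.toNNReal p.1

/-- The measure `φ(0) V(dy)`, the law of `G⁽⁰⁾`. -/
noncomputable def gLaw {Ω : Type*} [MeasurableSpace Ω] (S : ℝ≥0 → Ω → ℝ) (ζ : Ω → ℝ)
    (P : Measure Ω) : Measure ℝ :=
  ENNReal.ofReal (laplaceExponent S ζ P 0) • potentialMeasure S ζ P

/-- `ρ` is the law of a residual exponential functional for the Laplace exponent `φ`: a probability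
measure on `[0, ∞)` with entire moments `∫ xⁿ ρ(dx) = φ(1) ⋯ φ(n)`. -/
structure IsResidualLaw (φ : ℝ → ℝ) (ρ : Measure ℝ) : Prop where
  isProbabilityMeasure : IsProbabilityMeasure ρ
  nonneg : ρ (Iio 0) = 0
  integrable : ∀ n : ℕ, Integrable (fun x => x ^ n) ρ
  moment : ∀ n : ℕ, ∫ x, x ^ n ∂ρ = ∏ k ∈ Finset.Icc 1 n, φ k

/-- Complete monotonicity on `(0, ∞)`: infinitely differentiable there, with derivatives of alternating sign. -/
def IsCompletelyMonotone (h : ℝ → ℝ) : Prop :=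
  ContDiffOn ℝ (⊤ : ℕ∞) h (Ioi 0) ∧ ∀ n : ℕ, ∀ t : ℝ, 0 < t → 0 ≤ (-1) ^ n * iteratedDeriv n h t

/-- The law of `e · exp(G) / R` for independent `e`, `G`, `R`, where `e` is standard exponential,
`G` has law `γ` and `R` has law `ρ`. -/
noncomputable def factorLaw (γ ρ : Measure ℝ) : Measure ℝ :=
  ((expMeasure 1).prod (γ.prod ρ)).map fun p => p.1 * Real.exp p.2.1 / p.2.2

/-- The exponential functional `∫₀^ζ exp(σ_s) ds` (that is, `exp(σ_s) = 0` for `s ≥ ζ`). -/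
noncomputable def expFunctional {Ω : Type*} (S : ℝ≥0 → Ω → ℝ) (ζ : Ω → ℝ) (ω : Ω) : ℝ :=
  ∫ s in Ico 0 (ζ ω), Real.exp (S s.toNNReal ω)

open Filter Topology

/-! Write `φ` for the Laplace exponent. Conditioning on `(G, R)`, the tail of `e₁ exp(G) / R` at `t`
is the Laplace transform at `t` of the law of `exp(-G) R`. The `n`-th moment of that law is
`φ(0)/φ(n) * φ(1) ⋯ φ(n) = φ(0) ⋯ φ(n-1)`. So it suffices to show that a tail `F 0` fits into a
chain with `F n' = -F (n+1)` on `(0, ∞)`, continuous at `0` with `F n 0 = φ(0) ⋯ φ(n-1)`, and `|F n|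
≤ F n 0`. Concavity makes `φ` grow at most linearly, hence these values are at most `C ^ n * n!`. A
chain with such bounds is determined by its values at `0` (`eq_zero_of_factorial_bound`), so `F 0`
is the required Laplace transform (`hasLaw_factorLaw_of_chain`). The same principle, applied to
characteristic functions, shows that the residual law is determined by its moments.

Part (i): the chain is the tail of `W` followed by the signed derivatives of its density.
Differentiating the equation `n` times gives `F n t = ∫ exp(-n a) F (n+1) (t exp(-a)) V(da)`.
Letting `t` tend to `0`, monotone convergence and `∫ exp(-n a) V(da) = 1/φ(n)` give `F (n+1) 0 =
φ(n) F n 0`.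

Part (ii): let `τ` be the inverse of `u ↦ ∫₀ᵘ exp(σ)`. The functional exceeds `t` exactly when `τ(t)
< ζ`, which has probability `E exp(-q τ(t))`. The chain is `φ(0) ⋯ φ(n-1) * E exp(-q τ(t) - n
σ(τ(t)))`, with `σ` unkilled here. Its differential relation combines Dynkin's formula at `τ(t)`
(`integral_discount_clockInv_of_pos`) with the substitution `du = exp(-σ(τ(s))) ds`, which raises
`n` by one.

Existence of the residual law: `φ(n) exp(-G₁ - ⋯ - Gₙ)`, with independent `Gₖ` of law `φ(k) exp(-k
y) V(dy)`, has moments converging to the desired ones, and its inverse moment is `1/φ(0)` for all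
`n`. A weak limit point is the desired law, and it does not charge `0`. -/

/-! ### Uniqueness of functions with factorially bounded derivatives. -/

/-- Taylor's remainder bound: all members of the chain vanish at `0`, so the bound on `F (n + k)`
can be integrated `k` times. -/
theorem norm_le_of_hasDerivAt_chain {E : Type*} [NormedAddCommGroup E] [NormedSpace ℝ E]
    [CompleteSpace E] {F : ℕ → ℝ → E} {K C : ℝ}
    (hcont : ∀ n, ContinuousOn (F n) (Ici 0))
    (hderiv : ∀ n, ∀ t, 0 < t → HasDerivAt (F n) (F (n + 1) t) t)
    (hbound : ∀ n, ∀ t, 0 ≤ t → ‖F n t‖ ≤ K * C ^ n * n.factorial)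
    (h0 : ∀ n, F n 0 = 0) (k n : ℕ) (t : ℝ) (ht : 0 ≤ t) :
    ‖F n t‖ ≤ K * C ^ (n + k) * (n + k).factorial * (t ^ k / k.factorial) := by
  induction k generalizing n t with
  | zero => simpa using hbound n t ht
  | succ k ih =>
    have hc : ContinuousOn (F (n + 1)) (Icc 0 t) := (hcont _).mono Icc_subset_Ici_self
    have hint : IntervalIntegrable (F (n + 1)) volume 0 t :=
      (hc.mono (by rw [uIcc_of_le ht])).intervalIntegrable
    have hF : F n t = ∫ s in (0 : ℝ)..t, F (n + 1) s := by
      rw [intervalIntegral.integral_eq_sub_of_hasDerivAt_of_le ht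
        ((hcont n).mono Icc_subset_Ici_self) (fun s hs => hderiv n s hs.1) hint, h0, sub_zero]
    rw [hF]
    set c : ℝ := K * C ^ (n + 1 + k) * (n + 1 + k).factorial with hcdef
    calc ‖∫ s in (0 : ℝ)..t, F (n + 1) s‖
        ≤ ∫ s in (0 : ℝ)..t, c * (s ^ k / k.factorial) := by
          refine intervalIntegral.norm_integral_le_of_norm_le ht ?_ ?_
          · exact ae_of_all _ fun s hs => ih (n + 1) s hs.1.le
          · exact Continuous.intervalIntegrable (by fun_prop) _ _
      _ = K * C ^ (n + (k + 1)) * (n + (k + 1)).factorial * (t ^ (k + 1) / (k + 1).factorial) := by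
          rw [intervalIntegral.integral_const_mul, intervalIntegral.integral_div, integral_pow,
            hcdef, Nat.factorial_succ k, show n + 1 + k = n + (k + 1) by ring]
          push_cast
          field_simp
          simp

/-- Quasi-analyticity: the Taylor remainder tends to `0` on an interval whose length depends on `C`
alone. The bounds hold at every `t`, so the argument restarts from the end of each interval. -/
theorem eq_zero_of_factorial_bound {E : Type*} [NormedAddCommGroup E] [NormedSpace ℝ E]
    [CompleteSpace E] {F : ℕ → ℝ → E} {K C : ℝ} (hC : 0 < C)
    (hcont : ∀ n, ContinuousOn (F n) (Ici 0))
    (hderiv : ∀ n, ∀ t, 0 < t → HasDerivAt (F n) (F (n + 1) t) t)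
    (hbound : ∀ n, ∀ t, 0 ≤ t → ‖F n t‖ ≤ K * C ^ n * n.factorial)
    (h0 : ∀ n, F n 0 = 0) (n : ℕ) (t : ℝ) (ht : 0 ≤ t) : F n t = 0 := by
  have hK : 0 ≤ K := by simpa using (norm_nonneg _).trans (hbound 0 0 le_rfl)
  have main : ∀ G : ℕ → ℝ → E, (∀ n, ContinuousOn (G n) (Ici 0)) →
      (∀ n, ∀ t, 0 < t → HasDerivAt (G n) (G (n + 1) t) t) →
      (∀ n, ∀ t, 0 ≤ t → ‖G n t‖ ≤ K * C ^ n * n.factorial) → (∀ n, G n 0 = 0) →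
      ∀ n, ∀ t, 0 ≤ t → t ≤ 1 / (4 * C) → G n t = 0 := by
    intro G hc hd hb h0 n t ht htC
    have key : ∀ k : ℕ, ‖G n t‖ ≤ K * (2 * C) ^ n * n.factorial * (1 / 2) ^ k := by
      intro k
      refine (norm_le_of_hasDerivAt_chain hc hd hb h0 k n t ht).trans ?_
      -- The binomial coefficient costs `2 ^ (n + k)`, so the remainder is at most a constant times
      -- `(2 C t) ^ k`; the radius `1 / (4 C)` makes this geometric with ratio `1 / 2`.
      have hch : ((n + k).factorial : ℝ) ≤ 2 ^ (n + k) * n.factorial * k.factorial := by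
        have h1 := Nat.add_choose_mul_factorial_mul_factorial n k
        have h2 := Nat.choose_le_two_pow (n + k) k
        have : (n + k).factorial ≤ 2 ^ (n + k) * n.factorial * k.factorial := by
          rw [← h1]; gcongr
        exact_mod_cast this
      have htk : t ^ k ≤ (1 / (4 * C)) ^ k := by gcongr
      calc K * C ^ (n + k) * (n + k).factorial * (t ^ k / k.factorial)
          ≤ K * C ^ (n + k) * (2 ^ (n + k) * n.factorial * k.factorial) *
            ((1 / (4 * C)) ^ k / k.factorial) := by gcongr
        _ = K * (2 * C) ^ n * n.factorial * (1 / 2) ^ k := by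
            have : (1 / (4 * C)) ^ k = (1 / 2) ^ k / ((2 : ℝ) ^ k * C ^ k) := by
              rw [← mul_pow, ← div_pow]; congr 1; field_simp; norm_num
            rw [this]
            field_simp
            ring
    have hlim : Tendsto (fun k : ℕ => K * (2 * C) ^ n * n.factorial * (1 / 2 : ℝ) ^ k) atTop
        (𝓝 (K * (2 * C) ^ n * n.factorial * 0)) :=
      (tendsto_pow_atTop_nhds_zero_of_lt_one (by norm_num) (by norm_num)).const_mul _
    have := ge_of_tendsto' hlim key
    rw [mul_zero] at this
    exact norm_le_zero_iff.1 this
  have step : ∀ j : ℕ, ∀ n, ∀ t, 0 ≤ t → t ≤ j * (1 / (4 * C)) → F n t = 0 := by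
    intro j
    induction j with
    | zero =>
      intro n t ht htj
      have : t = 0 := le_antisymm (by simpa using htj) ht
      rw [this, h0]
    | succ j ih =>
      intro n t ht htj
      set a : ℝ := j * (1 / (4 * C)) with ha
      have ha0 : 0 ≤ a := by positivity
      rcases le_total t a with h | h
      · exact ih n t ht h
      · have := main (fun n s => F n (a + s)) (fun n => ?_) (fun n s hs => ?_)
          (fun n s hs => hbound n _ (by positivity))
          (fun n => by simpa using ih n a ha0 le_rfl) n (t - a) (by linarith)
          (by push_cast at htj; linarith)
        · simpa using this
        · exact (hcont n).comp (by fun_prop) fun s hs => by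
            simp only [mem_Ici] at hs ⊢; positivity
        · exact (hderiv n (a + s) (by positivity)).comp_const_add a s
  obtain ⟨j, hj⟩ := exists_nat_ge (t / (1 / (4 * C)))
  exact step j n t ht ((div_le_iff₀ (by positivity)).1 hj)

/-! ### Measures on the half-line with factorially bounded moments. -/

theorem norm_exp_mul_le_one {z : ℂ} (hz : z.re ≤ 0) {x t : ℝ} (hx : 0 ≤ x) (ht : 0 ≤ t) :
    ‖Complex.exp (z * x * t)‖ ≤ 1 := by
  rw [Complex.norm_exp, mul_assoc, ← Complex.ofReal_mul, Complex.re_mul_ofReal]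
  exact Real.exp_le_one_iff.2 (mul_nonpos_of_nonpos_of_nonneg hz (by positivity))

/-- The `n`-th derivative of `t ↦ ∫ exp (z x t) dκ(x)`. -/
noncomputable def expMoment (κ : Measure ℝ) (z : ℂ) (n : ℕ) (t : ℝ) : ℂ :=
  ∫ x, (z * x) ^ n * Complex.exp (z * x * t) ∂κ

section expMoment
variable {κ : Measure ℝ} {z : ℂ}

theorem norm_expMoment_integrand_le (hz : z.re ≤ 0) (hz1 : ‖z‖ = 1) (n : ℕ) {x t : ℝ}
    (hx : 0 ≤ x) (ht : 0 ≤ t) : ‖(z * x) ^ n * Complex.exp (z * x * t)‖ ≤ x ^ n := by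
  rw [norm_mul, norm_pow, norm_mul, hz1, one_mul, Complex.norm_real, Real.norm_of_nonneg hx]
  exact mul_le_of_le_one_right (by positivity) (norm_exp_mul_le_one hz hx ht)

theorem ae_nonneg_of_Iio (h : κ (Iio 0) = 0) : ∀ᵐ x ∂κ, 0 ≤ x := by
  rw [ae_iff]; convert h using 2; ext x; simp

variable (hκ : κ (Iio 0) = 0) (hint : ∀ n : ℕ, Integrable (fun x => x ^ n) κ)
  (hz : z.re ≤ 0) (hz1 : ‖z‖ = 1)
include hκ hint hz hz1

theorem norm_expMoment_le (n : ℕ) {t : ℝ} (ht : 0 ≤ t) :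
    ‖expMoment κ z n t‖ ≤ ∫ x, x ^ n ∂κ := by
  refine norm_integral_le_of_norm_le (hint n) ?_
  filter_upwards [ae_nonneg_of_Iio hκ] with x hx
  exact norm_expMoment_integrand_le hz hz1 n hx ht

theorem continuousOn_expMoment (n : ℕ) : ContinuousOn (expMoment κ z n) (Ici 0) := by
  refine continuousOn_of_dominated (bound := fun x => x ^ n) (fun t _ => ?_) (fun t ht => ?_)
    (hint n) (ae_of_all _ fun x => by fun_prop)
  · exact Continuous.aestronglyMeasurable (by fun_prop)
  · filter_upwards [ae_nonneg_of_Iio hκ] with x hx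
    exact norm_expMoment_integrand_le hz hz1 n hx ht

theorem hasDerivAt_expMoment (n : ℕ) {t : ℝ} (ht : 0 < t) :
    HasDerivAt (expMoment κ z n) (expMoment κ z (n + 1) t) t := by
  refine (hasDerivAt_integral_of_dominated_loc_of_deriv_le (s := Ioi 0)
    (F := fun (t x : ℝ) => (z * x) ^ n * Complex.exp (z * x * t))
    (F' := fun (t x : ℝ) => (z * x) ^ (n + 1) * Complex.exp (z * x * t))
    (bound := fun x => x ^ (n + 1))
    (Ioi_mem_nhds ht) (Eventually.of_forall fun s => ?_) ?_ ?_ ?_ (hint (n + 1)) ?_).2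
  · exact Continuous.aestronglyMeasurable (by fun_prop)
  · refine (hint n).mono' (Continuous.aestronglyMeasurable (by fun_prop)) ?_
    filter_upwards [ae_nonneg_of_Iio hκ] with x hx
    exact norm_expMoment_integrand_le hz hz1 n hx ht.le
  · exact Continuous.aestronglyMeasurable (by fun_prop)
  · filter_upwards [ae_nonneg_of_Iio hκ] with x hx s hs
    exact norm_expMoment_integrand_le hz hz1 (n + 1) hx (le_of_lt hs)
  · refine ae_of_all _ fun x s _ => ?_
    have h1 : HasDerivAt (fun s : ℝ => z * x * (s : ℂ)) (z * x) s := by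
      simpa using (Complex.ofRealCLM.hasDerivAt (x := s)).const_mul (z * x)
    exact (h1.cexp.const_mul ((z * x) ^ n)).congr_deriv (by ring)

end expMoment

theorem expMoment_zero_right (κ : Measure ℝ) (z : ℂ) (n : ℕ) :
    expMoment κ z n 0 = z ^ n * ((∫ x, x ^ n ∂κ : ℝ) : ℂ) := by
  rw [← integral_complex_ofReal, ← integral_const_mul]
  simp [expMoment, mul_pow]

/-- The moments are the derivatives at `0` of the characteristic function, up to powers of `z = ±i`,
so the difference of the two characteristic functions is a chain vanishing at `0`. -/
theorem Measure.ext_of_moments {μ ν : Measure ℝ} [IsFiniteMeasure μ] [IsFiniteMeasure ν]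
    (hμ : μ (Iio 0) = 0) (hν : ν (Iio 0) = 0)
    (hμi : ∀ n : ℕ, Integrable (fun x => x ^ n) μ) (hνi : ∀ n : ℕ, Integrable (fun x => x ^ n) ν)
    {K C : ℝ} (hC : 0 < C) (hb : ∀ n : ℕ, ∫ x, x ^ n ∂μ ≤ K * C ^ n * n.factorial)
    (heq : ∀ n : ℕ, ∫ x, x ^ n ∂μ = ∫ x, x ^ n ∂ν) : μ = ν := by
  have key : ∀ z : ℂ, z.re ≤ 0 → ‖z‖ = 1 → ∀ t : ℝ, 0 ≤ t →
      expMoment μ z 0 t = expMoment ν z 0 t := by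
    intro z hz hz1 t ht
    refine sub_eq_zero.1 (eq_zero_of_factorial_bound (K := 2 * K)
      (F := fun n t => expMoment μ z n t - expMoment ν z n t) hC
      (fun n => (continuousOn_expMoment hμ hμi hz hz1 n).sub
        (continuousOn_expMoment hν hνi hz hz1 n))
      (fun n t ht => (hasDerivAt_expMoment hμ hμi hz hz1 n ht).sub
        (hasDerivAt_expMoment hν hνi hz hz1 n ht))
      (fun n t ht => ?_) (fun n => by simp [expMoment_zero_right, heq]) 0 t ht)
    have h1 := norm_expMoment_le hμ hμi hz hz1 n ht
    have h2 := norm_expMoment_le hν hνi hz hz1 n ht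
    have h3 := hb n
    refine (norm_sub_le _ _).trans ?_
    rw [← heq] at h2
    linarith
  refine Measure.ext_of_charFun (funext fun t => ?_)
  simp only [charFun_apply_real]
  -- The uniqueness principle lives on `[0, ∞)`; negative arguments are reached by replacing `i`
  -- with `-i`.
  rcases le_total 0 t with ht | ht
  · have := key Complex.I (by simp) (by simp) t ht
    simp only [expMoment, pow_zero, one_mul] at this
    convert this using 4 <;> ring
  · have := key (-Complex.I) (by simp) (by simp) (-t) (by linarith)
    simp only [expMoment, pow_zero, one_mul] at this
    convert this using 4 <;> (push_cast; ring)

/-- The sequence `(-1) ^ n * F n` and the derivatives of the Laplace transform of `κ` (the case `z =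
-1`) agree at `0` and obey the same factorial bound. -/
theorem eq_laplace_of_chain {κ : Measure ℝ} {F : ℕ → ℝ → ℝ}
    (hκ : κ (Iio 0) = 0) (hint : ∀ n : ℕ, Integrable (fun x => x ^ n) κ)
    {K C : ℝ} (hC : 0 < C) (hb : ∀ n : ℕ, ∫ x, x ^ n ∂κ ≤ K * C ^ n * n.factorial)
    (hcont : ∀ n, ContinuousOn (F n) (Ici 0))
    (hderiv : ∀ n, ∀ t, 0 < t → HasDerivAt (F n) (-F (n + 1) t) t)
    (hF0 : ∀ n, F n 0 = ∫ x, x ^ n ∂κ) (hF : ∀ n, ∀ t, 0 ≤ t → |F n t| ≤ F n 0)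
    {t : ℝ} (ht : 0 ≤ t) : F 0 t = ∫ x, Real.exp (-(t * x)) ∂κ := by
  have hz : (-1 : ℂ).re ≤ 0 := by simp
  have hz1 : ‖(-1 : ℂ)‖ = 1 := by simp
  have := sub_eq_zero.1 (eq_zero_of_factorial_bound (K := 2 * K)
      (F := fun n t => (((-1) ^ n * F n t : ℝ) : ℂ) - expMoment κ (-1) n t) hC
      (fun n => ContinuousOn.sub (Complex.continuous_ofReal.comp_continuousOn
        (continuousOn_const.mul (hcont n)))
        (continuousOn_expMoment hκ hint hz hz1 n))
      (fun n t ht => ?_) (fun n t ht => ?_) (fun n => ?_) 0 t ht)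
  · have h2 : expMoment κ (-1) 0 t = ((∫ x, Real.exp (-(t * x)) ∂κ : ℝ) : ℂ) := by
      rw [← integral_complex_ofReal, expMoment]
      congr 1; ext x; push_cast; rw [pow_zero, one_mul]; congr 1; ring
    rw [h2] at this
    simpa using Complex.ofReal_injective this
  · refine HasDerivAt.sub ?_ (hasDerivAt_expMoment hκ hint hz hz1 n ht)
    exact ((hderiv n t ht).const_mul ((-1) ^ n)).ofReal_comp.congr_deriv (by congr 1; ring)
  · refine (norm_sub_le _ _).trans ?_
    have h1 := norm_expMoment_le hκ hint hz hz1 n ht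
    have h2 := hF n t ht
    have h3 := hb n
    rw [hF0] at h2
    rw [Complex.norm_real, norm_mul, norm_pow, norm_neg, norm_one, one_pow, one_mul,
      Real.norm_eq_abs]
    linarith
  · rw [expMoment_zero_right, hF0]; push_cast; simp

/-! ### The law of `e₁ exp(G) / R` recognised from its tail. -/

theorem expMeasure_Ioi {r : ℝ} (hr : 0 < r) {x : ℝ} (hx : 0 ≤ x) :
    expMeasure r (Ioi x) = ENNReal.ofReal (Real.exp (-(r * x))) := by
  have := isProbabilityMeasure_expMeasure hr
  have h1 := cdf_expMeasure_eq hr x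
  rw [if_pos hx, cdf_eq_real] at h1
  rw [← compl_Iic, measure_compl measurableSet_Iic (measure_ne_top _ _), measure_univ,
    ← ofReal_measureReal, h1, ← ENNReal.ofReal_one, ← ENNReal.ofReal_sub]
  · congr 1; ring
  · rw [sub_nonneg]; exact Real.exp_le_one_iff.2 (by have := mul_nonneg hr.le hx; linarith)

theorem Measure.ext_of_Ioi_of_nonneg {μ ν : Measure ℝ} [IsProbabilityMeasure μ]
    [IsProbabilityMeasure ν] (hμ : μ (Iic 0) = 0) (h : ∀ t, 0 ≤ t → μ (Ioi t) = ν (Ioi t)) :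
    μ = ν := by
  have hIic : ∀ t, 0 ≤ t → μ (Iic t) = ν (Iic t) := fun t ht => by
    rw [← compl_Ioi, measure_compl measurableSet_Ioi (measure_ne_top _ _),
      measure_compl measurableSet_Ioi (measure_ne_top _ _), h t ht, measure_univ, measure_univ]
  refine Measure.ext_of_Iic _ _ fun a => ?_
  rcases le_total 0 a with ha | ha
  · exact hIic a ha
  · rw [measure_mono_null (Iic_subset_Iic.2 ha) hμ,
      measure_mono_null (Iic_subset_Iic.2 ha) (hIic 0 le_rfl ▸ hμ)]

/-- The law of `exp(-G) * R` for independent `G`, `R` with laws `γ`, `ρ`. -/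
noncomputable def rateLaw (γ ρ : Measure ℝ) : Measure ℝ :=
  (γ.prod ρ).map fun p => Real.exp (-p.1) * p.2

theorem measurable_rate : Measurable fun p : ℝ × ℝ => Real.exp (-p.1) * p.2 := by fun_prop

/-- Given `(G, R)` with `R > 0`, the event reads `e₁ > t exp(-G) R`, which has conditional
probability `exp(-t exp(-G) R)`. -/
theorem factorLaw_Ioi (γ ρ : Measure ℝ) [IsProbabilityMeasure γ] [IsProbabilityMeasure ρ]
    (hρ : ρ (Iic 0) = 0) {t : ℝ} (ht : 0 ≤ t) :
    factorLaw γ ρ (Ioi t) = ENNReal.ofReal (∫ x, Real.exp (-(t * x)) ∂(rateLaw γ ρ)) := by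
  have := isProbabilityMeasure_expMeasure one_pos
  have hρpos : ∀ᵐ p ∂(γ.prod ρ), 0 < p.2 := by
    have : ∀ᵐ r ∂ρ, 0 < r := by
      rw [ae_iff]; convert hρ using 2; ext x; simp
    exact Measure.quasiMeasurePreserving_snd.ae this
  have hmeas : Measurable fun p : ℝ × ℝ × ℝ => p.1 * Real.exp p.2.1 / p.2.2 := by fun_prop
  rw [factorLaw, Measure.map_apply hmeas measurableSet_Ioi,
    Measure.prod_apply_symm (hmeas measurableSet_Ioi), rateLaw,
    integral_map measurable_rate.aemeasurable (by fun_prop),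
    ofReal_integral_eq_lintegral_ofReal]
  · refine lintegral_congr_ae ?_
    filter_upwards [hρpos] with p hp
    have : (fun x : ℝ => (x, p)) ⁻¹' ((fun p : ℝ × ℝ × ℝ => p.1 * Real.exp p.2.1 / p.2.2) ⁻¹' Ioi t)
        = Ioi (t * (Real.exp (-p.1) * p.2)) := by
      ext x
      simp only [mem_preimage, mem_Ioi]
      rw [lt_div_iff₀ hp, Real.exp_neg, ← mul_assoc, mul_right_comm, ← div_eq_mul_inv,
        div_lt_iff₀ (Real.exp_pos _)]
    rw [this, expMeasure_Ioi one_pos (by positivity), one_mul]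
  · refine (integrable_const (1 : ℝ)).mono' (by fun_prop) ?_
    filter_upwards [hρpos] with p hp
    rw [Real.norm_of_nonneg (Real.exp_pos _).le]
    exact Real.exp_le_one_iff.2 (neg_nonpos.2 (by positivity))
  · exact ae_of_all _ fun _ => (Real.exp_pos _).le

theorem isProbabilityMeasure_factorLaw (γ ρ : Measure ℝ) [IsProbabilityMeasure γ]
    [IsProbabilityMeasure ρ] : IsProbabilityMeasure (factorLaw γ ρ) := by
  have := isProbabilityMeasure_expMeasure one_pos
  exact Measure.isProbabilityMeasure_map (by fun_prop)

section rateLaw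
variable {γ ρ : Measure ℝ}

theorem rateLaw_Iio [SFinite ρ] (hρ : ρ (Iic 0) = 0) : rateLaw γ ρ (Iio 0) = 0 := by
  rw [rateLaw, Measure.map_apply measurable_rate measurableSet_Iio]
  refine measure_mono_null (t := univ ×ˢ Iic 0) (fun p hp => ?_) ?_
  · simp only [mem_preimage, mem_Iio] at hp
    simp only [mem_prod, mem_univ, true_and, mem_Iic]
    by_contra! h
    exact absurd hp (not_lt.2 (by positivity))
  · rw [Measure.prod_prod, hρ, mul_zero]

theorem integrable_rateLaw_pow [SFinite ρ] (n : ℕ)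
    (hγ : Integrable (fun y => Real.exp (-(n * y))) γ)
    (hρ : Integrable (fun x => x ^ n) ρ) : Integrable (fun x => x ^ n) (rateLaw γ ρ) := by
  rw [rateLaw, integrable_map_measure (by fun_prop) (by fun_prop)]
  convert hγ.mul_prod hρ using 2 with p
  simp only [Function.comp, mul_pow, ← Real.exp_nat_mul]
  ring_nf

theorem integral_rateLaw_pow [SFinite γ] [SFinite ρ] (n : ℕ) :
    ∫ x, x ^ n ∂(rateLaw γ ρ) = (∫ y, Real.exp (-(n * y)) ∂γ) * ∫ x, x ^ n ∂ρ := by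
  rw [rateLaw, integral_map (by fun_prop) (by fun_prop), ← integral_prod_mul]
  congr 1; ext p
  simp only [mul_pow, ← Real.exp_nat_mul]
  ring_nf

end rateLaw

/-- The common last step of (i) and (ii): by `hF0`, the values of the chain at `0` are the moments
of `exp(-G) R`. -/
theorem hasLaw_factorLaw_of_chain {Ω : Type*} [MeasurableSpace Ω] {P : Measure Ω}
    [IsProbabilityMeasure P] {W : Ω → ℝ} (hW : AEMeasurable W P) {γ ρ : Measure ℝ}
    [IsProbabilityMeasure γ] [IsProbabilityMeasure ρ] (hρ : ρ (Iic 0) = 0)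
    (hγi : ∀ n : ℕ, Integrable (fun y => Real.exp (-(n * y))) γ)
    (hρi : ∀ n : ℕ, Integrable (fun x => x ^ n) ρ)
    {K C : ℝ} (hC : 0 < C) {F : ℕ → ℝ → ℝ}
    (hb : ∀ n : ℕ, F n 0 ≤ K * C ^ n * n.factorial)
    (hcont : ∀ n, ContinuousOn (F n) (Ici 0))
    (hderiv : ∀ n, ∀ t, 0 < t → HasDerivAt (F n) (-F (n + 1) t) t)
    (hF0 : ∀ n : ℕ, F n 0 = (∫ y, Real.exp (-(n * y)) ∂γ) * ∫ x, x ^ n ∂ρ)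
    (hF : ∀ n, ∀ t, 0 ≤ t → |F n t| ≤ F n 0)
    (hWF : ∀ t, 0 ≤ t → P {ω | t < W ω} = ENNReal.ofReal (F 0 t)) :
    HasLaw W (factorLaw γ ρ) P := by
  refine ⟨hW, ?_⟩
  have := isProbabilityMeasure_factorLaw γ ρ
  have : IsProbabilityMeasure (P.map W) := Measure.isProbabilityMeasure_map hW
  have hmap : ∀ t, 0 ≤ t → P.map W (Ioi t) = ENNReal.ofReal (F 0 t) := fun t ht => by
    rw [Measure.map_apply_of_aemeasurable hW measurableSet_Ioi]
    exact hWF t ht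
  refine Measure.ext_of_Ioi_of_nonneg ?_ fun t ht => ?_
  -- The case `n = 0` of `hF0` gives `F 0 0 = 1`, so `W` is almost surely positive.
  · rw [← compl_Ioi, prob_compl_eq_zero_iff measurableSet_Ioi, hmap 0 le_rfl, hF0]
    simp
  · rw [hmap t ht, factorLaw_Ioi γ ρ hρ ht]
    congr 1
    have hm : ∀ n, F n 0 = ∫ x, x ^ n ∂(rateLaw γ ρ) := fun n => by
      rw [hF0, integral_rateLaw_pow]
    exact eq_laplace_of_chain (rateLaw_Iio hρ)
      (fun n => integrable_rateLaw_pow n (hγi n) (hρi n)) hC (fun n => hm n ▸ hb n)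
      hcont hderiv hm hF ht

/-- The moments of a residual law, reindexed. -/
theorem prod_Icc_one_eq_prod_range (φ : ℝ → ℝ) (n : ℕ) :
    ∏ k ∈ Finset.Icc 1 n, φ k = ∏ i ∈ Finset.range n, φ (i + 1 : ℕ) := by
  rw [← Finset.prod_image (g := fun i => i + 1) (f := fun k : ℕ => φ k) (by simp)]
  refine Finset.prod_congr ?_ fun _ _ => rfl
  ext k
  simp only [Finset.mem_Icc, Finset.mem_image, Finset.mem_range]
  exact ⟨fun h => ⟨k - 1, by lia, by lia⟩, fun ⟨a, h, h'⟩ => by lia⟩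

/-! ### Growth of positive concave sequences. -/

section concave
variable {φ : ℕ → ℝ}

theorem le_linear_of_concave
    (hconc : ∀ n, φ (n + 2) - φ (n + 1) ≤ φ (n + 1) - φ n) (n : ℕ) :
    φ n ≤ max (φ 0) (φ 1 - φ 0) * (n + 1) := by
  have hd : ∀ n, φ (n + 1) - φ n ≤ φ 1 - φ 0 := fun n => by
    induction n with
    | zero => simp
    | succ n ih => exact (hconc n).trans ih
  induction n with
  | zero => simp
  | succ n ih =>
    have := hd n
    have h2 := le_max_right (φ 0) (φ 1 - φ 0)
    push_cast
    linarith

/-- Concavity bounds all increments by the first one, so each factor is at most linear in its index;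
this is the growth condition required by the uniqueness principle. -/
theorem prod_le_factorial_of_concave (hpos : ∀ n, 0 < φ n)
    (hconc : ∀ n, φ (n + 2) - φ (n + 1) ≤ φ (n + 1) - φ n) (n : ℕ) :
    ∏ k ∈ Finset.range n, φ k ≤ max (φ 0) (φ 1 - φ 0) ^ n * n.factorial := by
  have hC : 0 < max (φ 0) (φ 1 - φ 0) := lt_max_of_lt_left (hpos 0)
  induction n with
  | zero => simp
  | succ n ih =>
    rw [Finset.prod_range_succ]
    calc _ ≤ (max (φ 0) (φ 1 - φ 0) ^ n * n.factorial) * (max (φ 0) (φ 1 - φ 0) * (n + 1)) := by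
          gcongr
          · exact (hpos _).le
          · exact le_linear_of_concave hconc n
      _ = _ := by rw [Nat.factorial_succ]; push_cast; ring

theorem tendsto_ratio_of_concave (hpos : ∀ n, 0 < φ n) (hmono : Monotone φ)
    (hconc : ∀ n, φ (n + 2) - φ (n + 1) ≤ φ (n + 1) - φ n) (i : ℕ) :
    Tendsto (fun n => φ n / φ (n + i)) atTop (𝓝 1) := by
  -- The current increment is the smallest so far, and `φ n` is at least the sum of the `n` previous
  -- ones. Hence `1 - 1 / n ≤ φ n / φ (n + 1)`.
  have hlow : ∀ n, n * (φ (n + 1) - φ n) ≤ φ n := fun n => by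
    induction n with
    | zero => simpa using (hpos 0).le
    | succ n ih =>
      have h1 := hconc n
      have h2 : ((n + 1 : ℕ) : ℝ) * (φ (n + 2) - φ (n + 1)) ≤ (n + 1 : ℕ) * (φ (n + 1) - φ n) := by
        gcongr
      push_cast at h2 ⊢
      linarith
  have h1 : Tendsto (fun n => φ n / φ (n + 1)) atTop (𝓝 1) := by
    have hl : Tendsto (fun n : ℕ => 1 - 1 / (n : ℝ)) atTop (𝓝 1) := by
      simpa using (tendsto_const_nhds (x := (1 : ℝ))).sub
        (tendsto_one_div_atTop_nhds_zero_nat (𝕜 := ℝ))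
    refine tendsto_of_tendsto_of_tendsto_of_le_of_le' hl tendsto_const_nhds ?_
      (Eventually.of_forall fun n => (div_le_one (hpos _)).2 (hmono n.le_succ))
    filter_upwards [eventually_gt_atTop 0] with n hn
    have hn' : (0 : ℝ) < n := by exact_mod_cast hn
    rw [le_div_iff₀ (hpos _), sub_mul, one_mul, div_mul_eq_mul_div, one_mul, sub_le_comm,
      le_div_iff₀ hn', mul_comm]
    exact (hlow n).trans (hmono n.le_succ)
  induction i with
  | zero => simpa using tendsto_const_nhds.congr fun n => (div_self (hpos n).ne').symm
  | succ i ih =>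
    have h2 := h1.comp (tendsto_add_atTop_nat i)
    have := ih.mul h2
    rw [one_mul] at this
    refine this.congr fun n => ?_
    simp only [Function.comp]
    rw [div_mul_div_cancel₀ (hpos _).ne', add_assoc]

end concave

/-! ### Existence of the residual law. -/

/-- First moments give tightness, higher moments give the uniform integrability that carries each
moment to the limit, and the bounded inverse moments prevent mass from accumulating at `0`. -/
theorem exists_measure_of_tendsto_moments {ρ : ℕ → Measure ℝ≥0}
    [∀ n, IsProbabilityMeasure (ρ n)] {A : ℕ → ℕ → ℝ≥0} {M : ℕ → ℝ≥0} {b : ℝ≥0}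
    (hA : ∀ n m : ℕ, ∫⁻ x, (x : ℝ≥0∞) ^ m ∂(ρ n) = A n m) (hAM : ∀ n m, A n m ≤ M m)
    (hlim : ∀ m, Tendsto (fun n => A n m) atTop (𝓝 (M m)))
    (hinv : ∀ n, ∫⁻ x, (x : ℝ≥0∞)⁻¹ ∂(ρ n) ≤ b) :
    ∃ ν : Measure ℝ≥0, IsProbabilityMeasure ν ∧
      (∀ m : ℕ, ∫⁻ x, (x : ℝ≥0∞) ^ m ∂ν = M m) ∧ ν {0} = 0 := by
  let π : ℕ → ProbabilityMeasure ℝ≥0 := fun n => ⟨ρ n, inferInstance⟩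
  have hu : Tendsto (fun k : ℕ => M 1 / (k + 1 : ℝ≥0)) atTop (𝓝 0) := by
    have := (tendsto_one_div_add_atTop_nhds_zero_nat (𝕜 := ℝ≥0)).const_mul (M 1)
    simpa [mul_one_div, div_eq_mul_inv] using this
  have hcpt := isCompact_setOfPred_probabilityMeasure_mass_eq_compl_isCompact_le
    (K := fun k : ℕ => Icc (0 : ℝ≥0) (k + 1)) hu (fun k => isCompact_Icc) (Or.inl inferInstance)
  have hmem : ∀ n, π n ∈ {μ : ProbabilityMeasure ℝ≥0 | ∀ k : ℕ,
      μ (Icc (0 : ℝ≥0) (k + 1))ᶜ ≤ M 1 / (k + 1 : ℝ≥0)} := by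
    intro n k
    rw [← ENNReal.coe_le_coe, ProbabilityMeasure.ennreal_coeFn_eq_coeFn_toMeasure,
      ENNReal.coe_div (by positivity)]
    have h1 := mul_meas_ge_le_lintegral₀ (μ := ρ n) (f := fun x : ℝ≥0 => (x : ℝ≥0∞))
      (by fun_prop) ((k + 1 : ℝ≥0) : ℝ≥0∞)
    have h2 := hA n 1
    simp only [pow_one] at h2
    rw [h2] at h1
    rw [ENNReal.le_div_iff_mul_le (Or.inl (by positivity)) (Or.inl (by simp)), mul_comm]
    refine le_trans ?_ (h1.trans (by exact_mod_cast hAM n 1))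
    change _ * ρ n _ ≤ _
    refine mul_le_mul_right (measure_mono fun x hx => ?_) _
    simp only [mem_compl_iff, mem_Icc, zero_le, true_and, not_le] at hx
    exact ENNReal.coe_le_coe.2 hx.le
  -- Convergence along a free ultrafilter replaces the extraction of a subsequence.
  obtain ⟨ν, -, hν⟩ := hcpt.ultrafilter_le_nhds ((hyperfilter ℕ).map π)
    (by rw [Ultrafilter.coe_map, le_principal_iff]; exact mem_map.2 (univ_mem' hmem))
  have hνlim : Tendsto π (hyperfilter ℕ) (𝓝 ν) := hν
  rw [ProbabilityMeasure.tendsto_iff_forall_lintegral_tendsto] at hνlim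
  have hlim' : ∀ m, Tendsto (fun n => ((A n m : ℝ≥0) : ℝ≥0∞)) (hyperfilter ℕ) (𝓝 (M m)) :=
    fun m => (ENNReal.tendsto_coe.2 (hlim m)).mono_left Nat.hyperfilter_le_atTop
  -- Weak convergence only tests bounded continuous functions, so powers are truncated at level `k`.
  let f : ℕ → ℕ → BoundedContinuousFunction ℝ≥0 ℝ≥0 := fun m k =>
    BoundedContinuousFunction.mkOfBound ⟨fun x => min x k ^ m, by fun_prop⟩ (k ^ m) (fun x y => by
      rw [NNReal.dist_eq, abs_sub_le_iff]
      have hx : ((min x k ^ m : ℝ≥0) : ℝ) ≤ k ^ m := by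
        have : min x (k : ℝ≥0) ^ m ≤ (k : ℝ≥0) ^ m := by gcongr; exact min_le_right _ _
        exact_mod_cast this
      have hy : ((min y k ^ m : ℝ≥0) : ℝ) ≤ k ^ m := by
        have : min y (k : ℝ≥0) ^ m ≤ (k : ℝ≥0) ^ m := by gcongr; exact min_le_right _ _
        exact_mod_cast this
      have h1 := NNReal.coe_nonneg (min x k ^ m)
      have h2 := NNReal.coe_nonneg (min y k ^ m)
      simp only [ContinuousMap.coe_mk]
      constructor <;> linarith)
  have hf : ∀ m k x, f m k x = min x (k : ℝ≥0) ^ m := fun m k x => rfl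
  refine ⟨ν, inferInstance, fun m => le_antisymm ?_ ?_, ?_⟩
  · have hmono : ∫⁻ x, (x : ℝ≥0∞) ^ m ∂(ν : Measure ℝ≥0) =
        ⨆ k, ∫⁻ x, f m k x ∂(ν : Measure ℝ≥0) := by
      rw [← lintegral_iSup (fun k => by fun_prop)]
      · refine lintegral_congr fun x => le_antisymm ?_ (iSup_le fun k => ?_)
        · obtain ⟨k, hk⟩ := exists_nat_ge x
          refine le_iSup_of_le k ?_
          rw [hf, min_eq_left hk]; simp
        · rw [hf]; norm_cast; gcongr; exact min_le_left _ _
      · intro k l hkl x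
        simp only [hf]
        norm_cast; gcongr
    rw [hmono]
    refine iSup_le fun k => le_of_tendsto' (hνlim (f m k)) fun n => ?_
    calc ∫⁻ x, f m k x ∂(ρ n) ≤ ∫⁻ x, (x : ℝ≥0∞) ^ m ∂(ρ n) := by
          refine lintegral_mono fun x => ?_
          rw [hf]; norm_cast; gcongr; exact min_le_left _ _
      _ ≤ M m := by rw [hA]; exact_mod_cast hAM n m
  -- Loss under truncation is controlled by the next moment: `x ^ m ≤ min(x, k+1) ^ m + x ^ (m+1) /
  -- (k+1)`.
  · have hk : ∀ k : ℕ, (M m : ℝ≥0∞) ≤ ∫⁻ x, (x : ℝ≥0∞) ^ m ∂(ν : Measure ℝ≥0) +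
        ((M (m + 1) * (1 / (k + 1) : ℝ≥0) : ℝ≥0) : ℝ≥0∞) := by
      intro k
      have h1 : ∀ n, ((A n m : ℝ≥0) : ℝ≥0∞) ≤ ∫⁻ x, f m (k + 1) x ∂(ρ n) +
          ((M (m + 1) * (1 / (k + 1) : ℝ≥0) : ℝ≥0) : ℝ≥0∞) := by
        intro n
        calc ((A n m : ℝ≥0) : ℝ≥0∞) = ∫⁻ x, (x : ℝ≥0∞) ^ m ∂(ρ n) := (hA n m).symm
          _ ≤ ∫⁻ x, (f m (k + 1) x + (x : ℝ≥0∞) ^ (m + 1) * ((1 / (k + 1) : ℝ≥0) : ℝ≥0∞))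
              ∂(ρ n) := by
            refine lintegral_mono fun x => ?_
            rw [hf]
            norm_cast
            rcases le_total x (k + 1 : ℕ) with h | h
            · rw [min_eq_left h]; exact ENNReal.coe_le_coe.2 le_self_add
            · refine ENNReal.coe_le_coe.2 (le_add_left ?_)
              rw [mul_one_div, le_div_iff₀ (by positivity), pow_succ]
              gcongr
          _ = ∫⁻ x, f m (k + 1) x ∂(ρ n) + A n (m + 1) * ((1 / (k + 1) : ℝ≥0) : ℝ≥0∞) := by
            rw [lintegral_add_left (by fun_prop), lintegral_mul_const _ (by fun_prop), hA]
          _ ≤ _ := by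
            rw [ENNReal.coe_mul]
            gcongr
            exact hAM _ _
      refine (le_of_tendsto_of_tendsto' (hlim' m) ((hνlim (f m (k + 1))).add_const _) h1).trans ?_
      gcongr with x
      rw [hf]; norm_cast; gcongr; exact min_le_left _ _
    have hz : Tendsto (fun k : ℕ => ∫⁻ x, (x : ℝ≥0∞) ^ m ∂(ν : Measure ℝ≥0) +
        ((M (m + 1) * (1 / (k + 1) : ℝ≥0) : ℝ≥0) : ℝ≥0∞)) atTop
        (𝓝 (∫⁻ x, (x : ℝ≥0∞) ^ m ∂(ν : Measure ℝ≥0) + ((M (m + 1) * 0 : ℝ≥0) : ℝ≥0∞))) :=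
      (ENNReal.tendsto_coe.2
        ((tendsto_one_div_add_atTop_nhds_zero_nat (𝕜 := ℝ≥0)).const_mul _)).const_add _
    rw [mul_zero, ENNReal.coe_zero, add_zero] at hz
    exact ge_of_tendsto' hz hk
  -- A bounded continuous minorant of `1 / x` taking the value `k + 1` at `0`; an atom of mass `p`
  -- at `0` would force `p * (k + 1) ≤ b` for every `k`.
  · let g : ℕ → BoundedContinuousFunction ℝ≥0 ℝ≥0 := fun k =>
      BoundedContinuousFunction.mkOfBound ⟨fun x => (x + 1 / (k + 1))⁻¹,
        Continuous.inv₀ (by fun_prop) fun x => by positivity⟩ (k + 1) (fun x y => by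
        rw [NNReal.dist_eq, abs_sub_le_iff]
        have hb : ∀ x : ℝ≥0, (((x + 1 / (k + 1))⁻¹ : ℝ≥0) : ℝ) ≤ k + 1 := fun x => by
          have : (x + 1 / (k + 1))⁻¹ ≤ (k + 1 : ℝ≥0) := by
            rw [inv_le_comm₀ (by positivity) (by positivity), ← one_div]
            exact le_add_self
          exact_mod_cast this
        have h1 := NNReal.coe_nonneg ((x + 1 / (k + 1))⁻¹)
        have h2 := NNReal.coe_nonneg ((y + 1 / (k + 1))⁻¹)
        have h3 := hb x
        have h4 := hb y
        simp only [ContinuousMap.coe_mk]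
        constructor <;> linarith)
    have hg : ∀ k x, g k x = (x + 1 / (k + 1))⁻¹ := fun k x => rfl
    have h1 : ∀ k : ℕ, (ν : Measure ℝ≥0) {0} * ((k + 1 : ℝ≥0) : ℝ≥0∞) ≤ b := by
      intro k
      have h2 : ∫⁻ x, g k x ∂(ν : Measure ℝ≥0) ≤ b := by
        refine le_of_tendsto' (hνlim (g k)) fun n => le_trans (lintegral_mono fun x => ?_) (hinv n)
        rw [hg, ENNReal.coe_inv (by positivity)]
        gcongr
        exact le_self_add
      refine le_trans ?_ h2
      rw [mul_comm]
      refine le_trans ?_ (setLIntegral_le_lintegral {0} _)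
      rw [Measure.restrict_singleton, lintegral_smul_measure, lintegral_dirac, hg]
      simp [mul_comm]
    by_contra hne
    have h2 : Tendsto (fun k : ℕ => (ν : Measure ℝ≥0) {0} * ((k + 1 : ℝ≥0) : ℝ≥0∞)) atTop
        (𝓝 ((ν : Measure ℝ≥0) {0} * ⊤)) := by
      refine ENNReal.Tendsto.const_mul ?_ (Or.inl (by simp))
      have := (tendsto_add_atTop_iff_nat 1).2 ENNReal.tendsto_nat_nhds_top
      simpa using this
    have h3 := le_of_tendsto' h2 h1
    rw [ENNReal.mul_top hne] at h3
    exact absurd h3 (by simp)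

/-- The law of `exp(-G)` where `G` has law `c * exp(-k y) V(dy)`. -/
noncomputable def decayLaw (V : Measure ℝ) (c : ℝ≥0) (k : ℕ) : Measure ℝ≥0 :=
  ((c : ℝ≥0∞) • V.withDensity fun y => ENNReal.ofReal (Real.exp (-(k * y)))).map
    fun y => (Real.exp (-y)).toNNReal

theorem lintegral_decayLaw (V : Measure ℝ) (c : ℝ≥0) (k : ℕ) {f : ℝ≥0 → ℝ≥0∞}
    (hf : Measurable f) : ∫⁻ x, f x ∂(decayLaw V c k) =
      c * ∫⁻ y, ENNReal.ofReal (Real.exp (-(k * y))) * f (Real.exp (-y)).toNNReal ∂V := by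
  rw [decayLaw, lintegral_map hf (by fun_prop), lintegral_smul_measure,
    lintegral_withDensity_eq_lintegral_mul _ (by fun_prop) (by fun_prop)]
  rfl

section decayLaw
variable {V : Measure ℝ} {φ : ℕ → ℝ≥0} (hφ : ∀ n, φ n ≠ 0)
  (hV : ∀ n : ℕ, ∫⁻ y, ENNReal.ofReal (Real.exp (-(n * y))) ∂V = ((φ n)⁻¹ : ℝ≥0))
include hV

theorem lintegral_pow_decayLaw (c : ℝ≥0) (k m : ℕ) :
    ∫⁻ x, (x : ℝ≥0∞) ^ m ∂(decayLaw V c k) = (c / φ (k + m) : ℝ≥0) := by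
  rw [lintegral_decayLaw V c k (by fun_prop), div_eq_mul_inv, ENNReal.coe_mul, ← hV]
  congr 1
  refine lintegral_congr fun y => ?_
  change _ * (ENNReal.ofReal (Real.exp (-y)))^m = _
  rw [← ENNReal.ofReal_pow (Real.exp_pos _).le,
    ← ENNReal.ofReal_mul (Real.exp_pos _).le, ← Real.exp_nat_mul, ← Real.exp_add]
  push_cast
  ring_nf

/-- The weight `exp(-(k + 1) y)` absorbs the inverse `exp(y)` and leaves the transform at `k`; the
product law therefore starts at index `1`. -/
theorem lintegral_inv_decayLaw (c : ℝ≥0) (k : ℕ) :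
    ∫⁻ x, (x : ℝ≥0∞)⁻¹ ∂(decayLaw V c (k + 1)) = (c / φ k : ℝ≥0) := by
  rw [lintegral_decayLaw V c _ (by fun_prop), div_eq_mul_inv, ENNReal.coe_mul, ← hV]
  congr 1
  refine lintegral_congr fun y => ?_
  change _ * (ENNReal.ofReal (Real.exp (-y)))⁻¹ = _
  rw [← ENNReal.ofReal_inv_of_pos (Real.exp_pos _),
    ← ENNReal.ofReal_mul (Real.exp_pos _).le, ← Real.exp_neg, ← Real.exp_add]
  push_cast
  ring_nf

include hφ in
theorem isProbabilityMeasure_decayLaw (k : ℕ) : IsProbabilityMeasure (decayLaw V (φ k) k) := by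
  constructor
  have := lintegral_pow_decayLaw hV (φ k) k 0
  simpa [div_self (hφ k)] using this

end decayLaw

theorem lintegral_mconv_of_mul {μ ν : Measure ℝ≥0} [SFinite ν] {f : ℝ≥0 → ℝ≥0∞}
    (hf : Measurable f) (hmul : ∀ x y, f (x * y) = f x * f y) :
    ∫⁻ z, f z ∂(μ ∗ₘ ν) = (∫⁻ x, f x ∂μ) * ∫⁻ y, f y ∂ν := by
  rw [Measure.lintegral_mconv hf]
  simp_rw [hmul]
  rw [← lintegral_mul_const _ hf]
  exact lintegral_congr fun x => lintegral_const_mul _ hf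

theorem NNReal.coe_mul_inv (x y : ℝ≥0) : ((x * y : ℝ≥0) : ℝ≥0∞)⁻¹ = (x : ℝ≥0∞)⁻¹ * (y : ℝ≥0∞)⁻¹ := by
  rw [ENNReal.coe_mul, ENNReal.mul_inv (Or.inr ENNReal.coe_ne_top) (Or.inl ENNReal.coe_ne_top)]

/-- The law of `exp(-G₁) ⋯ exp(-Gₙ)` for independent `Gₖ` with laws `φ(k) exp(-k y) V(dy)`. -/
noncomputable def decayProdLaw (V : Measure ℝ) (φ : ℕ → ℝ≥0) : ℕ → Measure ℝ≥0
  | 0 => Measure.dirac 1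
  | n + 1 => decayProdLaw V φ n ∗ₘ decayLaw V (φ (n + 1)) (n + 1)

section decayProdLaw
variable {V : Measure ℝ} {φ : ℕ → ℝ≥0} (hφ : ∀ n, φ n ≠ 0)
  (hV : ∀ n : ℕ, ∫⁻ y, ENNReal.ofReal (Real.exp (-(n * y))) ∂V = ((φ n)⁻¹ : ℝ≥0))
include hφ hV

theorem isProbabilityMeasure_decayProdLaw (n : ℕ) :
    IsProbabilityMeasure (decayProdLaw V φ n) := by
  induction n with
  | zero => exact Measure.dirac.isProbabilityMeasure
  | succ n ih =>
    have := isProbabilityMeasure_decayLaw hφ hV (n + 1)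
    rw [decayProdLaw]
    infer_instance

theorem lintegral_pow_decayProdLaw (n m : ℕ) :
    ∫⁻ x, (x : ℝ≥0∞) ^ m ∂(decayProdLaw V φ n) =
      (∏ i ∈ Finset.range m, φ (i + 1) / φ (n + (i + 1)) : ℝ≥0) := by
  induction n with
  | zero =>
    rw [decayProdLaw, lintegral_dirac' _ (by fun_prop),
      Finset.prod_congr rfl fun i _ => by rw [zero_add, div_self (hφ _)]]
    simp
  | succ n ih =>
    have := isProbabilityMeasure_decayLaw hφ hV (n + 1)
    rw [decayProdLaw, lintegral_mconv_of_mul (by fun_prop)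
      (fun x y => by rw [ENNReal.coe_mul, mul_pow]), ih, lintegral_pow_decayLaw hV,
      ← ENNReal.coe_mul]
    congr 1
    -- Both sides are the product of `φ (n + 1), …, φ (n + 1 + m)`, split off at the first or at the
    -- last factor.
    have h1 : φ (n + 1) * ∏ i ∈ Finset.range m, φ (n + 1 + (i + 1)) =
        φ (n + 1 + m) * ∏ i ∈ Finset.range m, φ (n + (i + 1)) := by
      have := Finset.prod_range_succ (fun i => φ (n + 1 + i)) m
      rw [Finset.prod_range_succ'] at this
      rw [mul_comm, mul_comm (φ (n + 1 + m))]
      convert this using 4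
      ring_nf
    rw [Finset.prod_div_distrib, Finset.prod_div_distrib, div_mul_div_comm,
      div_eq_div_iff (mul_ne_zero (Finset.prod_ne_zero_iff.2 fun _ _ => hφ _) (hφ _))
        (Finset.prod_ne_zero_iff.2 fun _ _ => hφ _), mul_assoc, h1]
    ring

theorem lintegral_inv_decayProdLaw (n : ℕ) :
    ∫⁻ x, (x : ℝ≥0∞)⁻¹ ∂(decayProdLaw V φ n) = (φ n / φ 0 : ℝ≥0) := by
  induction n with
  | zero => rw [decayProdLaw, lintegral_dirac' _ (by fun_prop), div_self (hφ _)]; simp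
  | succ n ih =>
    have := isProbabilityMeasure_decayLaw hφ hV (n + 1)
    rw [decayProdLaw, lintegral_mconv_of_mul (by fun_prop) NNReal.coe_mul_inv, ih,
      lintegral_inv_decayLaw hV, ← ENNReal.coe_mul, mul_comm, div_mul_div_cancel₀ (hφ _)]

/-- Scaling the `n`-fold product by `φ n` makes the `m`-th moment `∏ φ (i + 1) * (φ n / φ (n + i +
1))`. Monotonicity bounds it by its limit, and the inverse moment becomes exactly `1 / φ 0`. -/
theorem exists_nnreal_measure_moments (hmono : Monotone φ)
    (hratio : ∀ i, Tendsto (fun n => φ n / φ (n + i)) atTop (𝓝 1)) :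
    ∃ ν : Measure ℝ≥0, IsProbabilityMeasure ν ∧
      (∀ m : ℕ, ∫⁻ x, (x : ℝ≥0∞) ^ m ∂ν = (∏ i ∈ Finset.range m, φ (i + 1) : ℝ≥0)) ∧
        ν {0} = 0 := by
  have := isProbabilityMeasure_decayProdLaw hφ hV
  have : ∀ n, IsProbabilityMeasure ((decayProdLaw V φ n).map fun x => φ n * x) := fun n =>
    Measure.isProbabilityMeasure_map (by fun_prop)
  refine exists_measure_of_tendsto_moments
    (ρ := fun n => (decayProdLaw V φ n).map fun x => φ n * x)
    (A := fun n m => ∏ i ∈ Finset.range m, φ (i + 1) * (φ n / φ (n + (i + 1))))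
    (b := (φ 0)⁻¹) (fun n m => ?_) (fun n m => ?_) (fun m => ?_) (fun n => ?_)
  · rw [lintegral_map (by fun_prop) (by fun_prop)]
    simp_rw [ENNReal.coe_mul, mul_pow]
    rw [lintegral_const_mul _ (by fun_prop), lintegral_pow_decayProdLaw hφ hV]
    norm_cast
    rw [← Finset.card_range m, ← Finset.prod_const, Finset.card_range, ← Finset.prod_mul_distrib]
    exact Finset.prod_congr rfl fun i _ => by rw [mul_div_left_comm]
  · refine Finset.prod_le_prod' fun i _ => ?_
    exact mul_le_of_le_one_right' (div_le_one_of_le₀ (hmono (by lia)) zero_le)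
  · refine tendsto_finsetProd _ fun i _ => ?_
    simpa using (hratio (i + 1)).const_mul (φ (i + 1))
  · rw [lintegral_map (by fun_prop) (by fun_prop)]
    simp_rw [NNReal.coe_mul_inv]
    rw [lintegral_const_mul _ (by fun_prop), lintegral_inv_decayProdLaw hφ hV,
      ← ENNReal.coe_inv (hφ n), ← ENNReal.coe_mul]
    refine le_of_eq ?_
    congr 1
    rw [mul_div, inv_mul_cancel₀ (hφ n), one_div]

end decayProdLaw

theorem exists_residualLaw {V : Measure ℝ} {φ : ℝ → ℝ} (hpos : ∀ n : ℕ, 0 < φ n)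
    (hV : ∀ n : ℕ, ∫⁻ y, ENNReal.ofReal (Real.exp (-(n * y))) ∂V = ENNReal.ofReal (φ n)⁻¹)
    (hmono : Monotone fun n : ℕ => φ n)
    (hratio : ∀ i : ℕ, Tendsto (fun n : ℕ => φ n / φ (n + i : ℕ)) atTop (𝓝 1)) :
    ∃ ρ : Measure ℝ, IsResidualLaw φ ρ ∧ ρ (Iic 0) = 0 := by
  obtain ⟨ν, hν1, hν2, hν3⟩ := exists_nnreal_measure_moments (V := V)
    (φ := fun n => (φ n).toNNReal) (fun n => by simpa using hpos n)
    (fun n => by rw [hV, ENNReal.ofReal, Real.toNNReal_inv])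
    (fun m n h => Real.toNNReal_le_toNNReal (hmono h))
    (fun i => by
      have := (continuous_real_toNNReal.tendsto _).comp (hratio i)
      rw [Real.toNNReal_one] at this
      exact this.congr fun n => by simp [Real.toNNReal_div (hpos n).le])
  have hmeas : Measurable ((↑) : ℝ≥0 → ℝ) := by fun_prop
  have hpow : ∀ n : ℕ, ∫⁻ x : ℝ≥0, ENNReal.ofReal ((x : ℝ) ^ n) ∂ν =
      ENNReal.ofReal (∏ k ∈ Finset.Icc 1 n, φ k) := fun n => by
    rw [prod_Icc_one_eq_prod_range, ENNReal.ofReal, Real.toNNReal_prod_of_nonneg fun _ _ => (hpos _).le, ← hν2]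
    refine lintegral_congr fun x => ?_
    rw [ENNReal.ofReal_pow x.coe_nonneg, ENNReal.ofReal_coe_nnreal]
  refine ⟨ν.map (↑), ⟨Measure.isProbabilityMeasure_map hmeas.aemeasurable, ?_, fun n => ?_,
    fun n => ?_⟩, ?_⟩
  · rw [Measure.map_apply hmeas measurableSet_Iio]
    convert measure_empty (μ := ν)
    ext x; simp
  · rw [integrable_map_measure (by fun_prop) (by fun_prop)]
    refine ⟨by fun_prop, ?_⟩
    rw [hasFiniteIntegral_iff_ofReal (ae_of_all _ fun x => by simp)]
    simp only [Function.comp]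
    rw [hpow]
    exact ENNReal.ofReal_lt_top
  · rw [integral_map (by fun_prop) (by fun_prop), integral_eq_lintegral_of_nonneg_ae
      (ae_of_all _ fun x => by simp) (by fun_prop), hpow, ENNReal.toReal_ofReal]
    exact Finset.prod_nonneg fun _ _ => (hpos _).le
  · rw [Measure.map_apply hmeas measurableSet_Iic]
    convert hν3
    ext x
    rw [mem_preimage, mem_Iic, mem_singleton_iff, ← NNReal.coe_zero, NNReal.coe_le_coe,
      nonpos_iff_eq_zero]

/-! ### Differentiating the potential equation and letting `t` tend to `0`. -/

theorem ofReal_eq_add_lintegral_of_hasDerivAt_neg {f g : ℝ → ℝ} {s t : ℝ} (hs : 0 < s)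
    (hst : s ≤ t) (hf : ∀ u, 0 < u → HasDerivAt f (-g u) u) (hg : ContinuousOn g (Ioi 0))
    (hg0 : ∀ u, 0 < u → 0 ≤ g u) (hf0 : 0 ≤ f t) :
    ENNReal.ofReal (f s) = ENNReal.ofReal (f t) + ∫⁻ u in Ioc s t, ENNReal.ofReal (g u) := by
  have hsub : uIcc s t ⊆ Ioi 0 := by
    rw [uIcc_of_le hst]; exact fun u hu => hs.trans_le hu.1
  have hint : IntervalIntegrable g volume s t := (hg.mono hsub).intervalIntegrable
  have h1 : ∫ u in s..t, -g u = f t - f s :=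
    intervalIntegral.integral_eq_sub_of_hasDerivAt (fun u hu => hf u (hsub hu)) hint.neg
  rw [intervalIntegral.integral_neg] at h1
  have h2 : 0 ≤ᵐ[volume.restrict (Ioc s t)] g := by
    filter_upwards [ae_restrict_mem measurableSet_Ioc] with u hu using hg0 u (hs.trans hu.1)
  rw [← ofReal_integral_eq_lintegral_ofReal hint.1 h2, ← intervalIntegral.integral_of_le hst,
    ← ENNReal.ofReal_add hf0]
  · congr 1; linarith
  · rw [intervalIntegral.integral_of_le hst]; exact integral_nonneg_of_ae h2

/-- Comparing averages over `(s, t]` gives `f t ≤ G s` and `G t ≤ f s`, and continuity of `f` alone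
closes the gap. In this way the equation is differentiated without differentiating under the
integral. -/
theorem eq_of_setLIntegral_Ioc_eq {f : ℝ → ℝ} {G : ℝ → ℝ≥0∞} (hf : ContinuousOn f (Ioi 0))
    (hfanti : AntitoneOn f (Ioi 0)) (hG : AntitoneOn G (Ioi 0))
    (h : ∀ s t, 0 < s → s < t →
      ∫⁻ u in Ioc s t, ENNReal.ofReal (f u) = ∫⁻ u in Ioc s t, G u)
    {t : ℝ} (ht : 0 < t) : ENNReal.ofReal (f t) = G t := by
  have hpos : ∀ s t : ℝ, s < t → volume (Ioc s t) ≠ 0 := fun s t hst => by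
    rw [Real.volume_Ioc]; simpa using hst
  have hfin : ∀ s t : ℝ, volume (Ioc s t) ≠ ⊤ := fun s t => by simp
  have up : ∀ s t, 0 < s → s < t → ENNReal.ofReal (f t) ≤ G s := by
    intro s t hs hst
    have h1 : ENNReal.ofReal (f t) * volume (Ioc s t) ≤ G s * volume (Ioc s t) := by
      rw [← setLIntegral_const, ← setLIntegral_const]
      calc ∫⁻ _ in Ioc s t, ENNReal.ofReal (f t) ≤ ∫⁻ u in Ioc s t, ENNReal.ofReal (f u) :=
            setLIntegral_mono' measurableSet_Ioc fun u hu => ENNReal.ofReal_le_ofReal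
              (hfanti (hs.trans hu.1) (hs.trans hst) hu.2)
        _ = ∫⁻ u in Ioc s t, G u := h s t hs hst
        _ ≤ _ := setLIntegral_mono' measurableSet_Ioc fun u hu =>
              hG hs (hs.trans hu.1) hu.1.le
    exact (ENNReal.mul_le_mul_iff_left (hpos s t hst) (hfin s t)).1 h1
  have down : ∀ s t, 0 < s → s < t → G t ≤ ENNReal.ofReal (f s) := by
    intro s t hs hst
    have h1 : G t * volume (Ioc s t) ≤ ENNReal.ofReal (f s) * volume (Ioc s t) := by
      rw [← setLIntegral_const, ← setLIntegral_const]
      calc ∫⁻ _ in Ioc s t, G t ≤ ∫⁻ u in Ioc s t, G u :=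
            setLIntegral_mono' measurableSet_Ioc fun u hu =>
              hG (hs.trans hu.1) (hs.trans hst) hu.2
        _ = ∫⁻ u in Ioc s t, ENNReal.ofReal (f u) := (h s t hs hst).symm
        _ ≤ _ := setLIntegral_mono' measurableSet_Ioc fun u hu => ENNReal.ofReal_le_ofReal
              (hfanti hs (hs.trans hu.1) hu.1.le)
    exact (ENNReal.mul_le_mul_iff_left (hpos s t hst) (hfin s t)).1 h1
  have hct : ContinuousAt (fun u => ENNReal.ofReal (f u)) t :=
    ENNReal.continuous_ofReal.continuousAt.comp (hf.continuousAt (Ioi_mem_nhds ht))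
  refine le_antisymm ?_ ?_
  · refine le_of_tendsto (hct.tendsto.mono_left (nhdsWithin_le_nhds (s := Ioi t))) ?_
    filter_upwards [self_mem_nhdsWithin] with u hu using up t u ht hu
  · refine ge_of_tendsto (hct.tendsto.mono_left (nhdsWithin_le_nhds (s := Iio t))) ?_
    filter_upwards [self_mem_nhdsWithin, mem_nhdsWithin_of_mem_nhds (Ioi_mem_nhds ht)]
      with u hu hu0 using down u t hu0 hu

section chain
variable {V : Measure ℝ} [SFinite V] {F : ℕ → ℝ → ℝ} (hmeas : ∀ n, Measurable (F n))
  (hderiv : ∀ n, ∀ t, 0 < t → HasDerivAt (F n) (-F (n + 1) t) t)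
  (hnn : ∀ n, ∀ t, 0 < t → 0 ≤ F n t)

include hderiv in
theorem continuousOn_of_chain (n : ℕ) : ContinuousOn (F n) (Ioi 0) :=
  fun t ht => (hderiv n t ht).continuousAt.continuousWithinAt

include hderiv hnn in
theorem antitoneOn_of_chain (n : ℕ) : AntitoneOn (F n) (Ioi 0) := by
  refine antitoneOn_of_deriv_nonpos (convex_Ioi 0) (continuousOn_of_chain hderiv n)
    (fun t ht => ?_) (fun t ht => ?_)
  · rw [interior_Ioi] at ht
    exact (hderiv n t ht).differentiableAt.differentiableWithinAt
  · rw [interior_Ioi] at ht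
    rw [(hderiv n t ht).deriv]
    exact neg_nonpos.2 (hnn _ t ht)

include hmeas hderiv hnn in
-- The equations at `s` and `t` are subtracted, both sides are written as integrals over `(s, t]`,
-- and Tonelli makes the two candidate derivatives have equal averages. The chain rule contributes
-- the extra factor `exp(-a)`.
theorem potential_equation_succ (n : ℕ)
    (heq : ∀ t, 0 < t → ENNReal.ofReal (F n t) = ∫⁻ a, ENNReal.ofReal (Real.exp (-(n * a))) *
      ENNReal.ofReal (F (n + 1) (t * Real.exp (-a))) ∂V) {t : ℝ} (ht : 0 < t) :
    ENNReal.ofReal (F (n + 1) t) = ∫⁻ a, ENNReal.ofReal (Real.exp (-((n + 1 : ℕ) * a))) *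
      ENNReal.ofReal (F (n + 2) (t * Real.exp (-a))) ∂V := by
  refine eq_of_setLIntegral_Ioc_eq (f := F (n + 1)) (G := fun t =>
    ∫⁻ a, ENNReal.ofReal (Real.exp (-((n + 1 : ℕ) * a))) *
      ENNReal.ofReal (F (n + 2) (t * Real.exp (-a))) ∂V)
    (continuousOn_of_chain hderiv _) (antitoneOn_of_chain hderiv hnn _) ?_ ?_ ht
  · intro s hs t ht hst
    have hs' : 0 < s := hs
    have ht' : 0 < t := ht
    refine lintegral_mono fun a => ?_
    dsimp only
    gcongr
    exact antitoneOn_of_chain hderiv hnn _ (by simp only [mem_Ioi]; positivity)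
      (by simp only [mem_Ioi]; positivity) (by gcongr)
  · intro s t hs hst
    have ht : 0 < t := hs.trans hst
    have h1 := ofReal_eq_add_lintegral_of_hasDerivAt_neg hs hst.le (hderiv n)
      (continuousOn_of_chain hderiv (n + 1)) (hnn (n + 1)) (hnn n t ht)
    have h2 : ∀ a, ENNReal.ofReal (Real.exp (-(n * a))) *
        ENNReal.ofReal (F (n + 1) (s * Real.exp (-a))) =
        ENNReal.ofReal (Real.exp (-(n * a))) *
        ENNReal.ofReal (F (n + 1) (t * Real.exp (-a))) +
        ∫⁻ u in Ioc s t, ENNReal.ofReal (Real.exp (-((n + 1 : ℕ) * a))) *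
          ENNReal.ofReal (F (n + 2) (u * Real.exp (-a))) := by
      intro a
      have hc := Real.exp_pos (-a)
      have h3 := ofReal_eq_add_lintegral_of_hasDerivAt_neg hs hst.le
        (f := fun u => F (n + 1) (u * Real.exp (-a)))
        (g := fun u => Real.exp (-a) * F (n + 2) (u * Real.exp (-a)))
        (fun u hu => ?_) ?_ (fun u hu => mul_nonneg hc.le (hnn _ _ (by positivity)))
        (hnn _ _ (by positivity))
      · rw [h3, mul_add]
        congr 1
        rw [← lintegral_const_mul _ (by fun_prop)]
        refine lintegral_congr fun u => ?_
        rw [ENNReal.ofReal_mul hc.le, ← mul_assoc, ← ENNReal.ofReal_mul (Real.exp_pos _).le,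
          ← Real.exp_add]
        congr 3
        push_cast; ring
      · have := (hderiv (n + 1) (u * Real.exp (-a)) (by positivity)).comp u
          ((hasDerivAt_id u).mul_const (Real.exp (-a)))
        exact this.congr_deriv (by ring)
      · refine continuousOn_const.mul ((continuousOn_of_chain hderiv (n + 2)).comp
          (by fun_prop) fun u hu => ?_)
        have : 0 < u := hu
        simp only [mem_Ioi]; positivity
    have h4 := heq s hs
    simp_rw [h2] at h4
    have hF1 := hmeas (n + 1)
    have hF2 := hmeas (n + 2)
    rw [lintegral_add_left (by fun_prop), ← heq t ht, h1] at h4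
    rw [(ENNReal.add_right_inj ENNReal.ofReal_ne_top).1 h4, lintegral_lintegral_swap]
    exact Measurable.aemeasurable (by fun_prop)

variable {φ : ℕ → ℝ} (hφ : ∀ n, 0 < φ n)
  (hV : ∀ n : ℕ, ∫⁻ y, ENNReal.ofReal (Real.exp (-(n * y))) ∂V = ENNReal.ofReal (φ n)⁻¹)
  (heq : ∀ t, 0 < t → ENNReal.ofReal (F 0 t) =
    ∫⁻ a, ENNReal.ofReal (F 1 (t * Real.exp (-a))) ∂V)
  (hlim : Tendsto (F 0) (𝓝[>] 0) (𝓝 1))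
include hmeas hderiv hnn hφ hV heq hlim

/-- In the limit the `n`-th equation reads `F n (0+) = φ(n)⁻¹ * F (n+1) (0+)`. -/
theorem tendsto_ofReal_of_potential_equation (n : ℕ) :
    Tendsto (fun t => ENNReal.ofReal (F n t)) (𝓝[>] 0)
      (𝓝 (ENNReal.ofReal (∏ k ∈ Finset.range n, φ k))) := by
  have heqn : ∀ n : ℕ, ∀ t, 0 < t → ENNReal.ofReal (F n t) =
      ∫⁻ a, ENNReal.ofReal (Real.exp (-(n * a))) *
        ENNReal.ofReal (F (n + 1) (t * Real.exp (-a))) ∂V := by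
    intro n
    induction n with
    | zero => simpa using heq
    | succ n ih => exact fun t ht => potential_equation_succ hmeas hderiv hnn n ih ht
  have hanti : ∀ n, AntitoneOn (fun t => ENNReal.ofReal (F n t)) (Ioi 0) := fun n s hs t ht hst =>
    ENNReal.ofReal_le_ofReal (antitoneOn_of_chain hderiv hnn n hs ht hst)
  have hex : ∀ n, ∃ T, Tendsto (fun t => ENNReal.ofReal (F n t)) (𝓝[>] 0) (𝓝 T) := fun n =>
    ⟨_, (hanti n).tendsto_nhdsGT (OrderTop.bddAbove _)⟩
  induction n with
  | zero => simpa [Function.comp_def] using (ENNReal.continuous_ofReal.tendsto 1).comp hlim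
  | succ n ih =>
    obtain ⟨T, hT⟩ := hex (n + 1)
    -- Along `1 / (k + 1)` the integrands increase with `k`, so monotone convergence applies while
    -- `T` is not yet known to be finite.
    have hseq : ∀ c : ℝ, 0 < c →
        Tendsto (fun k : ℕ => 1 / ((k : ℝ) + 1) * c) atTop (𝓝[>] 0) := fun c hc => by
      refine tendsto_nhdsWithin_iff.2 ⟨?_, Eventually.of_forall fun k => ?_⟩
      · simpa using (tendsto_one_div_add_atTop_nhds_zero_nat (𝕜 := ℝ)).mul_const c
      · simp only [mem_Ioi]; positivity
    have hFm := hmeas (n + 1)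
    have h1 : Tendsto (fun k : ℕ => ∫⁻ a, ENNReal.ofReal (Real.exp (-(n * a))) *
        ENNReal.ofReal (F (n + 1) (1 / ((k : ℝ) + 1) * Real.exp (-a))) ∂V) atTop
        (𝓝 (∫⁻ a, ENNReal.ofReal (Real.exp (-(n * a))) * T ∂V)) := by
      refine lintegral_tendsto_of_tendsto_of_monotone (fun k => by fun_prop)
        (ae_of_all _ fun a => ?_) (ae_of_all _ fun a => ?_)
      · intro k l hkl
        dsimp only
        refine mul_le_mul_right (hanti (n + 1) ?_ ?_ ?_) _
        · simp only [mem_Ioi]; positivity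
        · simp only [mem_Ioi]; positivity
        · gcongr
      · exact ENNReal.Tendsto.const_mul (hT.comp (hseq _ (Real.exp_pos _)))
          (Or.inr ENNReal.ofReal_ne_top)
    rw [lintegral_mul_const _ (by fun_prop), hV] at h1
    have h2 := ih.comp (hseq 1 one_pos)
    have h3 : ENNReal.ofReal (∏ k ∈ Finset.range n, φ k) = ENNReal.ofReal (φ n)⁻¹ * T := by
      refine tendsto_nhds_unique h2 (h1.congr fun k => ?_)
      rw [← heqn n _ (by positivity), Function.comp, mul_one]
    have h4 : T = ENNReal.ofReal (∏ k ∈ Finset.range (n + 1), φ k) := by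
      rw [Finset.prod_range_succ, mul_comm, ENNReal.ofReal_mul (hφ n).le, h3, ← mul_assoc,
        ← ENNReal.ofReal_mul (hφ n).le, mul_inv_cancel₀ (hφ n).ne', ENNReal.ofReal_one, one_mul]
    rwa [← h4]

theorem tendsto_of_potential_equation (n : ℕ) :
    Tendsto (F n) (𝓝[>] 0) (𝓝 (∏ k ∈ Finset.range n, φ k)) := by
  have h1 := (ENNReal.tendsto_toReal ENNReal.ofReal_ne_top).comp
    (tendsto_ofReal_of_potential_equation hmeas hderiv hnn hφ hV heq hlim n)
  rw [ENNReal.toReal_ofReal (Finset.prod_nonneg fun _ _ => (hφ _).le)] at h1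
  refine h1.congr' ?_
  filter_upwards [self_mem_nhdsWithin] with t ht
  exact ENNReal.toReal_ofReal (hnn n t ht)

theorem le_prod_of_potential_equation (n : ℕ) {t : ℝ} (ht : 0 < t) :
    F n t ≤ ∏ k ∈ Finset.range n, φ k := by
  refine ge_of_tendsto
    (tendsto_of_potential_equation hmeas hderiv hnn hφ hV heq hlim n) ?_
  filter_upwards [self_mem_nhdsWithin, mem_nhdsWithin_of_mem_nhds (Iic_mem_nhds ht)] with u hu hut
  exact antitoneOn_of_chain hderiv hnn n hu ht hut

end chain

/-! ### Part (i): completely monotone solutions. -/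

theorem IsCompletelyMonotone.hasDerivAt_iteratedDeriv {h : ℝ → ℝ} (hh : IsCompletelyMonotone h)
    (n : ℕ) {t : ℝ} (ht : 0 < t) :
    HasDerivAt (iteratedDeriv n h) (iteratedDeriv (n + 1) h t) t := by
  have h1 : DifferentiableOn ℝ (iteratedDerivWithin n h (Ioi 0)) (Ioi 0) :=
    hh.1.differentiableOn_iteratedDerivWithin (by exact_mod_cast WithTop.coe_lt_top _)
      isOpen_Ioi.uniqueDiffOn
  have h2 : DifferentiableAt ℝ (iteratedDeriv n h) t :=
    ((h1.congr fun x hx => (iteratedDerivWithin_of_isOpen isOpen_Ioi hx).symm)).differentiableAt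
      (Ioi_mem_nhds ht)
  rw [iteratedDeriv_succ]
  exact h2.hasDerivAt

section density
variable {Ω : Type*} [MeasurableSpace Ω] {P : Measure Ω} [IsProbabilityMeasure P]
  {W : Ω → ℝ} {h : ℝ → ℝ}
  (hW : HasLaw W ((volume.restrict (Ioi 0)).withDensity fun u => ENNReal.ofReal (h u)) P)
include hW

omit [IsProbabilityMeasure P] in
theorem measure_lt_eq_setLIntegral {t : ℝ} (ht : 0 ≤ t) :
    P {ω | t < W ω} = ∫⁻ u in Ioi t, ENNReal.ofReal (h u) := by
  rw [hW.measure_eq (p := fun x => t < x) measurableSet_Ioi]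
  change Measure.withDensity _ _ (Ioi t) = _
  rw [withDensity_apply _ measurableSet_Ioi]
  rw [Measure.restrict_restrict measurableSet_Ioi, inter_eq_left.2 (Ioi_subset_Ioi ht)]

theorem measure_pos_eq_one : P {ω | 0 < W ω} = 1 := by
  have h1 : P {ω | 0 < W ω}ᶜ = 0 := by
    have : {ω | 0 < W ω}ᶜ = {ω | W ω ≤ 0} := by ext; simp
    rw [this, hW.measure_eq (p := fun x => x ≤ 0) measurableSet_Iic]
    change Measure.withDensity _ _ (Iic 0) = _
    rw [withDensity_apply _ measurableSet_Iic]
    rw [Measure.restrict_restrict measurableSet_Iic, Iic_inter_Ioi, Ioc_self]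
    simp
  exact (prob_compl_eq_zero_iff₀ (nullMeasurableSet_lt aemeasurable_const hW.aemeasurable)).1 h1

theorem hasDerivAt_tail (hh : ContinuousOn h (Ioi 0)) (hnn : ∀ t, 0 < t → 0 ≤ h t) {t : ℝ}
    (ht : 0 < t) : HasDerivAt (fun t => (P {ω | t < W ω}).toReal) (-h t) t := by
  have ht2 : 0 < t / 2 := by positivity
  have hev : (fun u => (P {ω | u < W ω}).toReal) =ᶠ[𝓝 t]
      fun u => (P {ω | t / 2 < W ω}).toReal - ∫ x in (t / 2)..u, h x := by
    filter_upwards [Ioi_mem_nhds (half_lt_self ht)] with u hu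
    have hu0 : 0 < u := ht2.trans hu
    have hle : t / 2 ≤ u := le_of_lt hu
    have hsub : uIcc (t / 2) u ⊆ Ioi 0 := by
      rw [uIcc_of_le hle]; exact fun x hx => ht2.trans_le hx.1
    have hint : IntervalIntegrable h volume (t / 2) u := (hh.mono hsub).intervalIntegrable
    have hnn' : 0 ≤ᵐ[volume.restrict (Ioc (t / 2) u)] h := by
      filter_upwards [ae_restrict_mem measurableSet_Ioc] with x hx using hnn x (ht2.trans hx.1)
    have h1 : P {ω | t / 2 < W ω} =
        ENNReal.ofReal (∫ x in (t / 2)..u, h x) + P {ω | u < W ω} := by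
      rw [measure_lt_eq_setLIntegral hW ht2.le, measure_lt_eq_setLIntegral hW hu0.le,
        intervalIntegral.integral_of_le hle, ofReal_integral_eq_lintegral_ofReal hint.1 hnn',
        ← lintegral_union measurableSet_Ioi (Ioc_disjoint_Ioi le_rfl), Ioc_union_Ioi_eq_Ioi hle]
    rw [h1, ENNReal.toReal_add ENNReal.ofReal_ne_top (measure_ne_top _ _), ENNReal.toReal_ofReal]
    · ring
    · rw [intervalIntegral.integral_of_le hle]; exact integral_nonneg_of_ae hnn'
  refine HasDerivAt.congr_of_eventuallyEq ?_ hev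
  have hsub : uIcc (t / 2) t ⊆ Ioi 0 := by
    rw [uIcc_of_le (half_le_self ht.le)]; exact fun x hx => ht2.trans_le hx.1
  have := intervalIntegral.integral_hasDerivAt_right ((hh.mono hsub).intervalIntegrable)
    (hh.stronglyMeasurableAtFilter isOpen_Ioi t ht) (hh.continuousAt (Ioi_mem_nhds ht))
  simpa using this.const_sub _

theorem tendsto_tail_one : Tendsto (fun t => (P {ω | t < W ω}).toReal) (𝓝[>] 0) (𝓝 1) := by
  have hanti : Antitone fun t => P {ω | t < W ω} := fun s t hst =>
    measure_mono fun ω (hω : t < W ω) => lt_of_le_of_lt hst hω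
  have h1 := (hanti.antitoneOn (Ioi 0)).tendsto_nhdsGT (OrderTop.bddAbove _)
  have hseq : Tendsto (fun k : ℕ => 1 / ((k : ℝ) + 1)) atTop (𝓝[>] 0) :=
    tendsto_nhdsWithin_iff.2 ⟨tendsto_one_div_add_atTop_nhds_zero_nat,
      Eventually.of_forall fun k => by simp only [mem_Ioi]; positivity⟩
  have h2 : Tendsto (fun k : ℕ => P {ω | 1 / ((k : ℝ) + 1) < W ω}) atTop (𝓝 1) := by
    rw [← measure_pos_eq_one hW]
    have : {ω | 0 < W ω} = ⋃ k : ℕ, {ω | 1 / ((k : ℝ) + 1) < W ω} := by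
      ext ω
      simp only [mem_ofPred_eq, mem_iUnion]
      exact ⟨exists_nat_one_div_lt, fun ⟨k, hk⟩ => lt_trans (by positivity) hk⟩
    rw [this]
    refine tendsto_measure_iUnion_atTop fun k l hkl => fun ω hω => ?_
    refine lt_of_le_of_lt ?_ (show 1 / ((k : ℝ) + 1) < W ω from hω)
    gcongr
  have h3 := tendsto_nhds_unique (h1.comp hseq) h2
  rw [h3] at h1
  simpa [Function.comp_def] using (ENNReal.tendsto_toReal ENNReal.one_ne_top).comp h1

end density

section potential
variable {V ρ : Measure ℝ} {φ : ℝ → ℝ} (hpos : ∀ n : ℕ, 0 < φ n)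
  (hV : ∀ n : ℕ, ∫⁻ y, ENNReal.ofReal (Real.exp (-(n * y))) ∂V = ENNReal.ofReal (φ n)⁻¹)
include hV

theorem lintegral_smul_potential (n : ℕ) :
    ∫⁻ y, ENNReal.ofReal (Real.exp (-(n * y))) ∂(ENNReal.ofReal (φ 0) • V) =
      ENNReal.ofReal (φ 0) * ENNReal.ofReal (φ n)⁻¹ := by
  rw [lintegral_smul_measure, hV, smul_eq_mul]

include hpos

theorem isProbabilityMeasure_smul_potential :
    IsProbabilityMeasure (ENNReal.ofReal (φ 0) • V) := by
  have h0 := hpos 0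
  rw [Nat.cast_zero] at h0
  have := lintegral_smul_potential hV 0
  rw [Nat.cast_zero, ← ENNReal.ofReal_mul h0.le, mul_inv_cancel₀ h0.ne'] at this
  exact ⟨by simpa using this⟩

omit hpos in
theorem integrable_exp_smul_potential (n : ℕ) :
    Integrable (fun y => Real.exp (-(n * y))) (ENNReal.ofReal (φ 0) • V) := by
  refine ⟨by fun_prop, ?_⟩
  rw [hasFiniteIntegral_iff_ofReal (ae_of_all _ fun x => (Real.exp_pos _).le),
    lintegral_smul_potential hV]
  exact ENNReal.mul_lt_top ENNReal.ofReal_lt_top ENNReal.ofReal_lt_top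

theorem integral_exp_smul_potential (n : ℕ) :
    ∫ y, Real.exp (-(n * y)) ∂(ENNReal.ofReal (φ 0) • V) = φ 0 * (φ n)⁻¹ := by
  have h0 := hpos 0
  have hn := hpos n
  rw [Nat.cast_zero] at h0
  rw [integral_eq_lintegral_of_nonneg_ae (ae_of_all _ fun x => (Real.exp_pos _).le)
    (by fun_prop), lintegral_smul_potential hV, ← ENNReal.ofReal_mul h0.le,
    ENNReal.toReal_ofReal (by positivity)]

theorem hasLaw_factorLaw_of_potential_chain (hρ : IsResidualLaw φ ρ) (hρ0 : ρ (Iic 0) = 0)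
    (hconc : ∀ n : ℕ, φ (n + 2 : ℕ) - φ (n + 1 : ℕ) ≤ φ (n + 1 : ℕ) - φ n)
    {Ω : Type*} [MeasurableSpace Ω] {P : Measure Ω} [IsProbabilityMeasure P] {W : Ω → ℝ}
    (hW : AEMeasurable W P) {F : ℕ → ℝ → ℝ}
    (hcont : ∀ n, ContinuousOn (F n) (Ici 0))
    (hderiv : ∀ n, ∀ t, 0 < t → HasDerivAt (F n) (-F (n + 1) t) t)
    (hF0 : ∀ n : ℕ, F n 0 = ∏ k ∈ Finset.range n, φ k)
    (hF : ∀ n, ∀ t, 0 ≤ t → |F n t| ≤ F n 0)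
    (hWF : ∀ t, 0 ≤ t → P {ω | t < W ω} = ENNReal.ofReal (F 0 t)) :
    HasLaw W (factorLaw (ENNReal.ofReal (φ 0) • V) ρ) P := by
  have := isProbabilityMeasure_smul_potential hpos hV
  have := hρ.isProbabilityMeasure
  refine hasLaw_factorLaw_of_chain hW hρ0 (integrable_exp_smul_potential hV) hρ.integrable
    (K := 1) (C := max (φ (0 : ℕ)) (φ (1 : ℕ) - φ (0 : ℕ))) (lt_max_of_lt_left (hpos 0))
    (fun n => ?_) hcont hderiv (fun n => ?_) hF hWF
  · rw [hF0, one_mul]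
    exact prod_le_factorial_of_concave (φ := fun n : ℕ => φ n) hpos hconc n
  · rw [integral_exp_smul_potential hpos hV, hρ.moment, hF0]
    -- Both sides equal `φ 0 ⋯ φ n`; dividing by `φ n` turns `φ 0 / φ n` times the residual moment
    -- into `φ 0 ⋯ φ (n - 1)`.
    have h1 : φ 0 * ∏ k ∈ Finset.Icc 1 n, φ k = (∏ k ∈ Finset.range n, φ k) * φ n := by
      rw [← Finset.prod_range_succ (fun k : ℕ => φ k), Finset.prod_range_succ', mul_comm,
        prod_Icc_one_eq_prod_range, Nat.cast_zero]
    rw [mul_right_comm, h1, mul_inv_cancel_right₀ (hpos n).ne']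

theorem hasLaw_factorLaw_of_completelyMonotone (hρ : IsResidualLaw φ ρ) (hρ0 : ρ (Iic 0) = 0)
    (hconc : ∀ n : ℕ, φ (n + 2 : ℕ) - φ (n + 1 : ℕ) ≤ φ (n + 1 : ℕ) - φ n)
    {Ω : Type*} [MeasurableSpace Ω] {P : Measure Ω} [IsProbabilityMeasure P] {W : Ω → ℝ}
    {h : ℝ → ℝ} (hh : IsCompletelyMonotone h)
    (hW : HasLaw W ((volume.restrict (Ioi 0)).withDensity fun u => ENNReal.ofReal (h u)) P)
    (heq : ∀ t : ℝ, 0 < t →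
      P {ω | t < W ω} = ∫⁻ a, ENNReal.ofReal (h (t * Real.exp (-a))) ∂V) :
    HasLaw W (factorLaw (ENNReal.ofReal (φ 0) • V) ρ) P := by
  have hfin : IsFiniteMeasure V := by
    have := hV 0
    exact ⟨by simp only [Nat.cast_zero, zero_mul, neg_zero, Real.exp_zero, ENNReal.ofReal_one,
      lintegral_const, one_mul] at this; rw [this]; exact ENNReal.ofReal_lt_top⟩
  -- For `t ≤ 0` the chain is given its expected limit at `0+`, so that continuity on `[0, ∞)`
  -- becomes `tendsto_of_potential_equation`.
  let F : ℕ → ℝ → ℝ := fun n t => if 0 < t then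
      (match n with
      | 0 => (P {ω | t < W ω}).toReal
      | n + 1 => (-1) ^ n * iteratedDeriv n h t)
    else ∏ k ∈ Finset.range n, φ k
  have hF0 : ∀ n, F n 0 = ∏ k ∈ Finset.range n, φ k := fun n => by simp [F]
  have hFz : ∀ t, 0 < t → F 0 t = (P {ω | t < W ω}).toReal := fun t ht => by simp [F, ht]
  have hFs : ∀ n t, 0 < t → F (n + 1) t = (-1) ^ n * iteratedDeriv n h t := fun n t ht => by
    simp [F, ht]
  have hnnh : ∀ t, 0 < t → 0 ≤ h t := fun t ht => by simpa using hh.2 0 t ht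
  have hderiv : ∀ n, ∀ t, 0 < t → HasDerivAt (F n) (-F (n + 1) t) t := by
    intro n t ht
    cases n with
    | zero =>
      refine HasDerivAt.congr_of_eventuallyEq ?_
        (f₁ := F 0) (f := fun t => (P {ω | t < W ω}).toReal) ?_
      · rw [hFs 0 t ht]
        simpa using hasDerivAt_tail hW hh.1.continuousOn hnnh ht
      · filter_upwards [Ioi_mem_nhds ht] with u hu using hFz u hu
    | succ n =>
      refine HasDerivAt.congr_of_eventuallyEq ?_
        (f₁ := F (n + 1)) (f := fun t => (-1) ^ n * iteratedDeriv n h t) ?_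
      · rw [hFs (n + 1) t ht]
        exact ((hh.hasDerivAt_iteratedDeriv n ht).const_mul _).congr_deriv (by ring)
      · filter_upwards [Ioi_mem_nhds ht] with u hu using hFs n u hu
  have hnn : ∀ n, ∀ t, 0 < t → 0 ≤ F n t := by
    intro n t ht
    cases n with
    | zero => rw [hFz t ht]; exact ENNReal.toReal_nonneg
    | succ n => rw [hFs n t ht]; exact hh.2 n t ht
  have hmeas : ∀ n, Measurable (F n) := by
    intro n
    have h1 := (continuousOn_of_chain hderiv n).measurable_piecewise
      (continuousOn_const (c := ∏ k ∈ Finset.range n, φ k) (s := (Ioi 0)ᶜ))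
      (measurableSet_Ioi (a := (0 : ℝ)))
    convert h1 using 1
    ext t
    by_cases ht : 0 < t
    · rw [piecewise_eq_of_mem _ _ _ (mem_Ioi.2 ht)]
    · rw [piecewise_eq_of_notMem _ _ _ (by simpa using ht)]
      simp [F, ht]
  have heqF : ∀ t, 0 < t → ENNReal.ofReal (F 0 t) =
      ∫⁻ a, ENNReal.ofReal (F 1 (t * Real.exp (-a))) ∂V := by
    intro t ht
    rw [hFz t ht, ENNReal.ofReal_toReal (measure_ne_top _ _), heq t ht]
    refine lintegral_congr fun a => ?_
    rw [hFs 0 _ (by positivity)]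
    simp
  have hlim : Tendsto (F 0) (𝓝[>] 0) (𝓝 1) := by
    refine (tendsto_tail_one hW).congr' ?_
    filter_upwards [self_mem_nhdsWithin] with t ht using (hFz t ht).symm
  refine hasLaw_factorLaw_of_potential_chain hpos hV hρ hρ0 hconc hW.aemeasurable
    (F := F) (fun n t ht => ?_) hderiv hF0 (fun n t ht => ?_) (fun t ht => ?_)
  · rcases eq_or_lt_of_le (show 0 ≤ t from ht) with rfl | ht
    · rw [← continuousWithinAt_Ioi_iff_Ici, ContinuousWithinAt, hF0]
      exact tendsto_of_potential_equation hmeas hderiv hnn (φ := fun n : ℕ => φ n)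
        hpos hV heqF hlim n
    · exact (hderiv n t ht).continuousAt.continuousWithinAt
  · rcases eq_or_lt_of_le ht with rfl | ht
    · rw [hF0, abs_of_nonneg (Finset.prod_nonneg fun _ _ => (hpos _).le)]
    · rw [abs_of_nonneg (hnn n t ht), hF0]
      exact le_prod_of_potential_equation hmeas hderiv hnn (φ := fun n : ℕ => φ n)
        hpos hV heqF hlim n ht
  · rcases eq_or_lt_of_le ht with rfl | ht
    · simp [measure_pos_eq_one hW, F]
    · rw [hFz t ht, ENNReal.ofReal_toReal (measure_ne_top _ _)]

end potential

/-! ### Time change along a single path. -/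

/-- A right-continuous non-decreasing path vanishing on `(-∞, 0]`. -/
structure IsIncreasingPath (g : ℝ → ℝ) : Prop where
  monotone : Monotone g
  right_continuous : ∀ u, ContinuousWithinAt g (Ici u) u
  eq_zero : ∀ u ≤ 0, g u = 0

/-- The additive functional `u ↦ ∫₀ᵘ exp(g(s)) ds`. -/
noncomputable def clock (g : ℝ → ℝ) (u : ℝ) : ℝ := ∫ s in (0 : ℝ)..u, Real.exp (g s)

/-- The time change inverse to `clock g`. -/
noncomputable def clockInv (g : ℝ → ℝ) : ℝ → ℝ := Function.invFun (clock g)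

/-- `u ↦ exp(-q u - l g(u))`. -/
noncomputable def discount (q l : ℝ) (g : ℝ → ℝ) (u : ℝ) : ℝ := Real.exp (-(q * u + l * g u))

theorem hasDerivWithinAt_integral_of_rightContinuous {f : ℝ → ℝ} (a : ℝ)
    (hf : ∀ a b, IntervalIntegrable f volume a b) (hm : Measurable f)
    {u : ℝ} (hc : ContinuousWithinAt f (Ici u) u) :
    HasDerivWithinAt (fun u => ∫ s in a..u, f s) (f u) (Ici u) u :=
  intervalIntegral.integral_hasDerivWithinAt_right (t := Ioi u) (hf a u)
    (hm.stronglyMeasurable.stronglyMeasurableAtFilter) (hc.mono Ioi_subset_Ici_self)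

namespace IsIncreasingPath
variable {g : ℝ → ℝ} (hg : IsIncreasingPath g)
include hg

theorem nonneg (u : ℝ) : 0 ≤ g u := by
  rcases le_total u 0 with h | h
  · rw [hg.eq_zero u h]
  · rw [← hg.eq_zero 0 le_rfl]; exact hg.monotone h

theorem exp_monotone : Monotone fun s => Real.exp (g s) :=
  fun _ _ h => Real.exp_le_exp.2 (hg.monotone h)

theorem intervalIntegrable_exp (a b : ℝ) :
    IntervalIntegrable (fun s => Real.exp (g s)) volume a b :=
  hg.exp_monotone.intervalIntegrable

theorem sub_le_clock_sub {u v : ℝ} (h : u ≤ v) : v - u ≤ clock g v - clock g u := by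
  rw [clock, clock, intervalIntegral.integral_interval_sub_left (hg.intervalIntegrable_exp _ _)
    (hg.intervalIntegrable_exp _ _)]
  have := intervalIntegral.integral_mono_on h (f := fun _ => (1 : ℝ)) (by simp)
    (hg.intervalIntegrable_exp u v) (fun s _ => Real.one_le_exp (hg.nonneg s))
  simpa using this

omit hg in
theorem clock_zero : clock g 0 = 0 := by simp [clock]

theorem le_clock {u : ℝ} (h : 0 ≤ u) : u ≤ clock g u := by
  simpa [clock_zero] using hg.sub_le_clock_sub h

theorem strictMono_clock : StrictMono (clock g) := fun u v h => by
  have := hg.sub_le_clock_sub h.le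
  linarith

theorem continuous_clock : Continuous (clock g) :=
  intervalIntegral.continuous_primitive hg.intervalIntegrable_exp 0

/-- The clock runs at speed at least one on the whole line, since `g ≥ 0` (and `g = 0` at negative
times), so it is unbounded in both directions. -/
theorem surjective_clock : Function.Surjective (clock g) := by
  refine hg.continuous_clock.surjective ?_ ?_
  · refine tendsto_atTop_mono' _ ?_ tendsto_id
    filter_upwards [eventually_ge_atTop 0] with u hu using hg.le_clock hu
  · refine tendsto_atBot_mono' _ ?_ tendsto_id
    filter_upwards [eventually_le_atBot 0] with u hu
    have := hg.sub_le_clock_sub hu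
    rw [clock_zero] at this
    simp only [id]
    linarith

theorem clock_clockInv (t : ℝ) : clock g (clockInv g t) = t :=
  Function.invFun_eq (hg.surjective_clock t)

theorem clockInv_le_iff {t u : ℝ} : clockInv g t ≤ u ↔ t ≤ clock g u := by
  rw [← hg.strictMono_clock.le_iff_le, hg.clock_clockInv]

theorem lt_clockInv_iff {t u : ℝ} : u < clockInv g t ↔ clock g u < t := by
  rw [← not_le, hg.clockInv_le_iff, not_le]

theorem strictMono_clockInv : StrictMono (clockInv g) := fun s t h => by
  rw [hg.lt_clockInv_iff, hg.clock_clockInv]; exact h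

theorem surjective_clockInv : Function.Surjective (clockInv g) := fun u =>
  ⟨clock g u, hg.strictMono_clock.injective (hg.clock_clockInv _)⟩

theorem continuous_clockInv : Continuous (clockInv g) :=
  hg.strictMono_clockInv.monotone.continuous_of_surjective hg.surjective_clockInv

theorem clockInv_zero : clockInv g 0 = 0 :=
  hg.strictMono_clock.injective (by rw [hg.clock_clockInv, clock_zero])

theorem clockInv_nonneg {t : ℝ} (ht : 0 ≤ t) : 0 ≤ clockInv g t := by
  rw [← hg.clockInv_zero]; exact hg.strictMono_clockInv.monotone ht

theorem clockInv_le {t : ℝ} (ht : 0 ≤ t) : clockInv g t ≤ t :=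
  hg.clockInv_le_iff.2 (hg.le_clock ht)

theorem hasDerivWithinAt_clock (u : ℝ) :
    HasDerivWithinAt (clock g) (Real.exp (g u)) (Ici u) u :=
  hasDerivWithinAt_integral_of_rightContinuous 0 hg.intervalIntegrable_exp
    hg.exp_monotone.measurable
    (Real.continuous_exp.continuousAt.comp_continuousWithinAt (hg.right_continuous u))

theorem tendsto_clockInv_right (t : ℝ) :
    Tendsto (clockInv g) (𝓝[≥] t) (𝓝[≥] (clockInv g t)) :=
  tendsto_nhdsWithin_iff.2 ⟨hg.continuous_clockInv.continuousAt.tendsto.mono_left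
    nhdsWithin_le_nhds, by
      filter_upwards [self_mem_nhdsWithin] with s hs
      exact hg.strictMono_clockInv.monotone hs⟩

/-- The path may jump, so only right derivatives are available; they suffice for the fundamental
theorem of calculus. -/
theorem hasDerivWithinAt_clockInv (t : ℝ) :
    HasDerivWithinAt (clockInv g) (Real.exp (g (clockInv g t)))⁻¹ (Ici t) t := by
  let e := ContinuousLinearEquiv.unitsEquivAut ℝ
    (Units.mk0 (Real.exp (g (clockInv g t))) (Real.exp_ne_zero _))
  have he : (e : ℝ →L[ℝ] ℝ) =
      ContinuousLinearMap.toSpanSingleton ℝ (Real.exp (g (clockInv g t))) := by ext; simp [e]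
  have h1 : HasFDerivWithinAt (clock g) (e : ℝ →L[ℝ] ℝ) (Ici (clockInv g t)) (clockInv g t) := by
    rw [he]
    exact (hg.hasDerivWithinAt_clock (clockInv g t)).hasFDerivWithinAt
  refine (HasFDerivWithinAt.of_local_left_inverse (hg.tendsto_clockInv_right t) h1 self_mem_Ici
    (Eventually.of_forall hg.clock_clockInv)).hasDerivWithinAt.congr_deriv ?_
  simp [e]

variable {q l : ℝ} (hq : 0 ≤ q) (hl : 0 ≤ l)
include hq hl

theorem antitone_discount : Antitone (discount q l g) := fun u v h => by
  have := hg.monotone h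
  unfold discount
  gcongr

theorem discount_le_one {u : ℝ} (hu : 0 ≤ u) : discount q l g u ≤ 1 := by
  have := hg.nonneg u
  exact Real.exp_le_one_iff.2 (neg_nonpos.2 (by positivity))

omit hq hl in
theorem rightContinuous_discount (u : ℝ) : ContinuousWithinAt (discount q l g) (Ici u) u :=
  Real.continuous_exp.continuousAt.comp_continuousWithinAt
    (((continuousWithinAt_id.const_mul q).add ((hg.right_continuous u).const_mul l)).neg)

theorem intervalIntegrable_discount (a b : ℝ) :
    IntervalIntegrable (discount q l g) volume a b :=
  (hg.antitone_discount hq hl).intervalIntegrable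

/-- Substituting `u = clockInv g s` gives `du = exp(-g u) ds`, which turns `l` into `l + 1`. This is
the source of the shift in the index of the chain. -/
theorem integral_discount_clockInv {t : ℝ} (ht : 0 ≤ t) :
    ∫ u in (0 : ℝ)..clockInv g t, discount q l g u =
      ∫ s in (0 : ℝ)..t, discount q (l + 1) g (clockInv g s) := by
  have hanti : Antitone fun s => discount q (l + 1) g (clockInv g s) := fun s t h =>
    hg.antitone_discount hq (by positivity) (hg.strictMono_clockInv.monotone h)
  rw [intervalIntegral.integral_eq_sub_of_hasDeriv_right_of_le ht
    (f := fun t => ∫ u in (0 : ℝ)..clockInv g t, discount q l g u) ?_ (fun s _ => ?_)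
    hanti.intervalIntegrable]
  · simp [hg.clockInv_zero]
  · exact ((intervalIntegral.continuous_primitive (hg.intervalIntegrable_discount hq hl) 0).comp
      hg.continuous_clockInv).continuousOn
  · have h1 := hasDerivWithinAt_integral_of_rightContinuous 0
      (hg.intervalIntegrable_discount hq hl) (hg.antitone_discount hq hl).measurable
      (hg.rightContinuous_discount (clockInv g s))
    have h2 := h1.comp s (hg.hasDerivWithinAt_clockInv s)
      (fun x hx => hg.strictMono_clockInv.monotone hx)
    refine (h2.congr_deriv ?_).mono Ioi_subset_Ici_self
    rw [discount, discount, ← Real.exp_neg, ← Real.exp_add]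
    congr 1; ring

end IsIncreasingPath

/-! ### Riemann sums, measurability and an additive functional equation. -/

theorem Antitone.abs_sum_sub_integral_le {z : ℝ → ℝ} (hz : Antitone z) (hz0 : ∀ u, 0 ≤ z u)
    (hz1 : z 0 ≤ 1) {h τ : ℝ} (hh : 0 < h) {k : ℕ} (hk : τ ≤ k * h) (hτ : 0 ≤ τ)
    (hk' : ((k : ℝ) - 1) * h ≤ τ) :
    |h * ∑ j ∈ Finset.range k, z (j * h) - ∫ u in (0 : ℝ)..τ, z u| ≤ h := by
  have hint : ∀ a b, IntervalIntegrable z volume a b := fun a b => hz.intervalIntegrable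
  have hlow : ∀ k : ℕ, ∫ u in (0 : ℝ)..(k * h), z u ≤ h * ∑ j ∈ Finset.range k, z (j * h) := by
    intro k
    induction k with
    | zero => simp
    | succ k ih =>
      rw [Finset.sum_range_succ, mul_add,
        ← intervalIntegral.integral_add_adjacent_intervals (hint 0 (k * h)) (hint _ _)]
      refine add_le_add ih ?_
      have hle : (k : ℝ) * h ≤ ((k + 1 : ℕ) : ℝ) * h := by push_cast; linarith
      have := intervalIntegral.integral_mono_on hle (hint _ _) (g := fun _ => z (k * h))
        (by simp) (fun s hs => hz hs.1)
      refine this.trans (le_of_eq ?_)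
      rw [intervalIntegral.integral_const, smul_eq_mul]; push_cast; ring
  have hup : ∀ k : ℕ, h * ∑ j ∈ Finset.range k, z ((j + 1 : ℕ) * h) ≤
      ∫ u in (0 : ℝ)..(k * h), z u := by
    intro k
    induction k with
    | zero => simp
    | succ k ih =>
      rw [Finset.sum_range_succ, mul_add,
        ← intervalIntegral.integral_add_adjacent_intervals (hint 0 (k * h)) (hint _ _)]
      refine add_le_add ih ?_
      have hle : (k : ℝ) * h ≤ ((k + 1 : ℕ) : ℝ) * h := by push_cast; linarith
      have := intervalIntegral.integral_mono_on hle (f := fun _ => z ((k + 1 : ℕ) * h))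
        (by simp) (hint _ _) (fun s hs => hz hs.2)
      refine le_trans (le_of_eq ?_) this
      rw [intervalIntegral.integral_const, smul_eq_mul]; push_cast; ring
  have hmono : ∀ a b, a ≤ b → ∫ u in (0 : ℝ)..a, z u ≤ ∫ u in (0 : ℝ)..b, z u := by
    intro a b hab
    rw [← intervalIntegral.integral_add_adjacent_intervals (hint 0 a) (hint a b)]
    exact le_add_of_nonneg_right (intervalIntegral.integral_nonneg hab fun u _ => hz0 u)
  have h1 := hmono _ _ hk
  -- The left sum dominates the integral; without its first term, which is at most `h`, it is a
  -- right sum over a shorter interval and is dominated by the integral.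
  rw [abs_le]
  refine ⟨by linarith [hlow k], ?_⟩
  cases k with
  | zero => simp; linarith [hmono 0 τ hτ, intervalIntegral.integral_same (f := z) (a := 0) (μ := volume)]
  | succ k =>
    have h2 := hup k
    have h3 := hmono (k * h) τ (by push_cast at hk'; linarith)
    rw [Finset.sum_range_succ', mul_add]
    have h4 : h * z ((0 : ℕ) * h) ≤ h := by
      rw [Nat.cast_zero, zero_mul]; exact mul_le_of_le_one_right hh.le hz1
    linarith

/-- The time is rounded up to the grid of mesh `1 / (k + 1)`, which leaves countably many times and
approximates from the side of continuity. -/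
theorem measurable_uncurry_of_rightContinuous {Ω : Type*} [MeasurableSpace Ω] {Y : ℝ → Ω → ℝ}
    (hY : ∀ t, Measurable (Y t))
    (hc : ∀ ω t, ContinuousWithinAt (fun s => Y s ω) (Ici t) t) :
    Measurable fun p : ℝ × Ω => Y p.1 p.2 := by
  refine measurable_of_tendsto_metrizable
    (f := fun (k : ℕ) (p : ℝ × Ω) => Y ((⌈p.1 * (k + 1)⌉ : ℝ) / (k + 1)) p.2) (fun k => ?_) ?_
  · have h1 : Measurable fun p : ℤ × Ω => Y ((p.1 : ℝ) / (k + 1)) p.2 :=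
      measurable_from_prod_countable_right fun z => hY ((z : ℝ) / (k + 1))
    exact h1.comp (((measurable_fst.mul_const ((k : ℝ) + 1)).ceil).prodMk measurable_snd)
  · rw [tendsto_pi_nhds]
    rintro ⟨t, ω⟩
    refine (hc ω t).tendsto.comp (tendsto_nhdsWithin_iff.2 ⟨?_, Eventually.of_forall fun k => ?_⟩)
    · have hl : Tendsto (fun k : ℕ => t + 1 / ((k : ℝ) + 1)) atTop (𝓝 t) := by
        simpa using (tendsto_const_nhds (x := t)).add
          (tendsto_one_div_add_atTop_nhds_zero_nat (𝕜 := ℝ))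
      refine tendsto_of_tendsto_of_tendsto_of_le_of_le tendsto_const_nhds hl
        (fun k => ?_) fun k => ?_
      · have hk : (0 : ℝ) < k + 1 := by positivity
        exact (le_div_iff₀ hk).2 (Int.le_ceil _)
      · have hk : (0 : ℝ) < k + 1 := by positivity
        dsimp only
        rw [div_le_iff₀ hk, add_mul, one_div, inv_mul_cancel₀ hk.ne']
        exact (Int.ceil_lt_add_one _).le
    · have hk : (0 : ℝ) < k + 1 := by positivity
      exact (le_div_iff₀ hk).2 (Int.le_ceil _)

theorem eq_mul_of_add_nonneg {f : ℝ≥0 → ℝ} (hadd : ∀ s t, f (s + t) = f s + f t)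
    (h0 : ∀ t, 0 ≤ f t) (t : ℝ≥0) : f t = t * f 1 := by
  have hmono : ∀ s t, s ≤ t → f s ≤ f t := fun s t h => by
    obtain ⟨c, rfl⟩ := exists_add_of_le h
    rw [hadd]; exact le_add_of_nonneg_right (h0 c)
  have hz : f 0 = 0 := by have := hadd 0 0; rw [add_zero] at this; linarith
  have hmul : ∀ (n : ℕ) (s : ℝ≥0), f (n * s) = n * f s := fun n s => by
    induction n with
    | zero => simp [hz]
    | succ n ih => push_cast; rw [add_mul, hadd, ih, one_mul]; ring
  -- Squeezing `n t` between consecutive integers bounds the error by `f 1` whatever `n` is.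
  have hle : ∀ n : ℕ, (n : ℝ) * |f t - t * f 1| ≤ f 1 := by
    intro n
    have h1 : (⌊(n * t : ℝ≥0)⌋₊ : ℝ≥0) ≤ n * t := Nat.floor_le zero_le
    have h2 : (n * t : ℝ≥0) ≤ ((⌊(n * t : ℝ≥0)⌋₊ + 1 : ℕ) : ℝ≥0) := by
      exact_mod_cast (Nat.lt_floor_add_one (n * t : ℝ≥0)).le
    have h3 := hmono _ _ h1
    have h4 := hmono _ _ h2
    have h5 := hmul ⌊(n * t : ℝ≥0)⌋₊ 1
    have h6 := hmul (⌊(n * t : ℝ≥0)⌋₊ + 1) 1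
    rw [mul_one] at h5 h6
    rw [h5, hmul] at h3
    rw [h6, hmul] at h4
    have h7 : ((⌊(n * t : ℝ≥0)⌋₊ : ℝ)) ≤ n * t := by exact_mod_cast h1
    have h8 : (n * t : ℝ) ≤ (⌊(n * t : ℝ≥0)⌋₊ : ℝ) + 1 := by exact_mod_cast h2
    have h9 := mul_le_mul_of_nonneg_right h7 (h0 1)
    have h10 := mul_le_mul_of_nonneg_right h8 (h0 1)
    push_cast at h4
    rw [← abs_of_nonneg (Nat.cast_nonneg (α := ℝ) n), ← abs_mul, abs_le]
    constructor <;> nlinarith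
  by_contra hne
  have hpos : 0 < |f t - t * f 1| := abs_pos.2 (sub_ne_zero.2 hne)
  obtain ⟨n, hn⟩ := exists_nat_gt (f 1 / |f t - t * f 1|)
  rw [div_lt_iff₀ hpos] at hn
  exact absurd (hle n) (not_le.2 hn)

/-! ### Subordinators: independence of the past and the Laplace exponent. -/

section increments
variable {Ω : Type*} [MeasurableSpace Ω] {P : Measure Ω} {X : ℝ≥0 → Ω → ℝ}

/-- Finitely many past times suffice, and their values are partial sums of increments that are
jointly independent of the future one. -/
theorem HasIndepIncrements.indepFun_past [IsProbabilityMeasure P] (hX : HasIndepIncrements X P)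
    (hm : ∀ t, Measurable (X t)) (h0 : ∀ ω, X 0 ω = 0) {a b : ℝ≥0} (hab : a ≤ b) :
    IndepFun (fun ω (s : Iic a) => X s ω) (fun ω => X b ω - X a ω) P := by
  refine IndepFun.process_indepFun (fun s => hm s) ((hm b).sub (hm a)) fun I => ?_
  let J : Finset ℝ≥0 := insert 0 (I.image Subtype.val)
  have hJa : ∀ x ∈ J, x ≤ a := by
    intro x hx
    simp only [J, Finset.mem_insert, Finset.mem_image] at hx
    rcases hx with rfl | ⟨y, -, rfl⟩
    · exact zero_le
    · exact y.2
  let m := J.card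
  have hm0 : 0 < m := Finset.card_pos.2 ⟨0, Finset.mem_insert_self _ _⟩
  let e := J.orderEmbOfFin (rfl : J.card = m)
  -- The past times in increasing order, with `0` inserted as the first, then `a` at index `m` and
  -- `b` afterwards: the `m`-th increment is `X b - X a`.
  let t : ℕ → ℝ≥0 := fun i => if h : i < m then e ⟨i, h⟩ else if i = m then a else b
  have ht : Monotone t := by
    intro i j hij
    by_cases hj : j < m
    · have hi : i < m := hij.trans_lt hj
      simp only [t, hi, hj, dif_pos]
      exact e.monotone hij
    · by_cases hi : i < m
      · simp only [t, hi, hj, dif_pos, dif_neg, not_false_eq_true]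
        have := hJa _ (J.orderEmbOfFin_mem rfl ⟨i, hi⟩)
        split_ifs
        · exact this
        · exact this.trans hab
      · simp only [t, hi, hj, dif_neg, not_false_eq_true]
        split_ifs with h1 h2
        · exact le_rfl
        · exact hab
        · lia
        · exact le_rfl
  have ht0 : t 0 = 0 := by
    simp only [t, hm0, dif_pos]
    refine le_antisymm ?_ zero_le
    have h1 : (0 : ℝ≥0) ∈ J := Finset.mem_insert_self _ _
    rw [Finset.orderEmbOfFin_zero rfl hm0]
    exact Finset.min'_le _ _ h1
  have hD := (hX.nat ht).indepFun_finset (Finset.range m) {m} (by simp)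
    (fun i => (hm _).sub (hm _))
  have hidx : ∀ s : I, ∃ i : ℕ, i < m ∧ t i = s := by
    intro s
    have hs : ((s : Iic a) : ℝ≥0) ∈ J :=
      Finset.mem_insert_of_mem (Finset.mem_image_of_mem _ s.2)
    have : ((s : Iic a) : ℝ≥0) ∈ Set.range e := by
      rw [Finset.range_orderEmbOfFin]; exact hs
    obtain ⟨i, hi⟩ := this
    exact ⟨i, i.2, by simp only [t, show (i : ℕ) < m from i.2, dif_pos, hi]⟩
  choose idx hidx1 hidx2 using hidx
  have hsum : ∀ n, n ≤ m → ∀ ω,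
      X (t n) ω = ∑ i ∈ Finset.range n, (X (t (i + 1)) ω - X (t i) ω) := by
    intro n _ ω
    rw [Finset.sum_range_sub (fun i => X (t i) ω), ht0, h0, sub_zero]
  let ψ : (({m} : Finset ℕ) → ℝ) → ℝ := fun x => x ⟨m, Finset.mem_singleton_self m⟩
  have hψ : Measurable ψ := measurable_pi_apply (⟨m, Finset.mem_singleton_self m⟩ : ({m} : Finset ℕ))
  have h1 := hD.comp
    (φ := fun (x : Finset.range m → ℝ) (s : I) =>
      ∑ i ∈ (Finset.univ : Finset (Finset.range m)), if (i : ℕ) < idx s then x i else 0)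
    (ψ := ψ)
    (measurable_pi_lambda _ fun s => Finset.measurable_sum _ fun i _ => by
      split_ifs <;> fun_prop) hψ
  convert h1 using 1
  · ext ω s
    simp only [Function.comp]
    rw [← hidx2 s, hsum _ (hidx1 s).le,
      Finset.sum_coe_sort (Finset.range m)
        (fun i => if i < idx s then X (t (i + 1)) ω - X (t i) ω else 0), ← Finset.sum_filter]
    refine Finset.sum_congr ?_ fun _ _ => rfl
    ext i
    have := hidx1 s
    simp only [Finset.mem_range, Finset.mem_filter]
    lia
  · ext ω
    simp [t, ψ]

end increments

/-- The path `u ↦ X_u(ω)`, extended to negative times by `X_0(ω)`. -/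
def realPath {Ω : Type*} (X : ℝ≥0 → Ω → ℝ) (ω : Ω) (u : ℝ) : ℝ := X u.toNNReal ω

/-- A subordinator all of whose paths are regular. -/
structure IsRegularSubordinator {Ω : Type*} [MeasurableSpace Ω] (X : ℝ≥0 → Ω → ℝ)
    (P : Measure Ω) : Prop where
  measurable : ∀ t, Measurable (X t)
  path : ∀ ω, IsIncreasingPath (realPath X ω)
  indep_increments : HasIndepIncrements X P
  stationary_increments : ∀ s t : ℝ≥0, IdentDistrib (fun ω => X (s + t) ω - X s ω) (X t) P P

/-- `-log E[exp(-l X₁)]`. -/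
noncomputable def laplaceCumulant {Ω : Type*} [MeasurableSpace Ω] (X : ℝ≥0 → Ω → ℝ)
    (P : Measure Ω) (l : ℝ) : ℝ := -Real.log (∫ ω, Real.exp (-(l * X 1 ω)) ∂P)

theorem measurable_clock_of_past {Ω : Type*} [MeasurableSpace Ω] {X : ℝ≥0 → Ω → ℝ}
    (hpath : ∀ ω, IsIncreasingPath (realPath X ω)) (a : ℝ≥0) (hm : ∀ s ≤ a, Measurable (X s)) :
    Measurable fun ω => clock (realPath X ω) a := by
  have h1 : Measurable fun p : ℝ × Ω => realPath X p.2 (min p.1 a) := by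
    refine measurable_uncurry_of_rightContinuous (Y := fun s ω => realPath X ω (min s a))
      (fun t => hm _ ?_) fun ω t => ?_
    · rw [Real.toNNReal_le_iff_le_coe]; exact min_le_right _ _
    · exact ContinuousWithinAt.comp (f := fun s => min s (a : ℝ)) (x := t)
        ((hpath ω).right_continuous (min t a))
        ((continuous_id.min continuous_const).continuousWithinAt) fun s hs =>
          mem_Ici.2 (min_le_min_right _ hs)
  have h2 : ∀ ω, clock (realPath X ω) a =
      ∫ s in Ioc (0 : ℝ) a, Real.exp (realPath X ω (min s a)) := by
    intro ω
    rw [clock, intervalIntegral.integral_of_le a.coe_nonneg]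
    refine setIntegral_congr_fun measurableSet_Ioc fun s hs => ?_
    simp only [min_eq_left hs.2]
  simp_rw [h2]
  have h3 : Measurable fun p : Ω × ℝ => Real.exp (realPath X p.1 (min p.2 a)) :=
    (h1.comp measurable_swap).exp
  exact (h3.stronglyMeasurable.integral_prod_right' (ν := volume.restrict (Ioc 0 (a : ℝ)))).measurable

theorem measurable_clockInv_of_process {Ω : Type*} [MeasurableSpace Ω] {X : ℝ≥0 → Ω → ℝ}
    (hpath : ∀ ω, IsIncreasingPath (realPath X ω)) (hm : ∀ s, Measurable (X s)) {t : ℝ}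
    (ht : 0 ≤ t) : Measurable fun ω => clockInv (realPath X ω) t := by
  refine measurable_of_Iic fun u => ?_
  have : (fun ω => clockInv (realPath X ω) t) ⁻¹' Iic u = {ω | t ≤ clock (realPath X ω) u} := by
    ext ω; exact (hpath ω).clockInv_le_iff
  rw [this]
  rcases le_total 0 u with hu | hu
  · exact measurableSet_le measurable_const
      (measurable_clock_of_past hpath ⟨u, hu⟩ fun s _ => hm s)
  · rcases eq_or_lt_of_le hu with rfl | hu
    · simp only [IsIncreasingPath.clock_zero]
      exact MeasurableSet.const _
    · convert MeasurableSet.empty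
      ext ω
      have := (hpath ω).strictMono_clock hu
      rw [IsIncreasingPath.clock_zero] at this
      simp only [mem_ofPred_eq, mem_empty_iff_false, iff_false]
      linarith

namespace IsRegularSubordinator
variable {Ω : Type*} [MeasurableSpace Ω] {P : Measure Ω} [IsProbabilityMeasure P]
  {X : ℝ≥0 → Ω → ℝ} (hX : IsRegularSubordinator X P)
include hX

omit [IsProbabilityMeasure P] in
theorem nonneg (t : ℝ≥0) (ω : Ω) : 0 ≤ X t ω := by
  have := (hX.path ω).nonneg t
  simpa [realPath] using this

omit [IsProbabilityMeasure P] in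
theorem zero (ω : Ω) : X 0 ω = 0 := by
  have := (hX.path ω).eq_zero 0 le_rfl
  simpa [realPath] using this

omit [IsProbabilityMeasure P] in
theorem measurable_realPath : Measurable fun p : ℝ × Ω => realPath X p.2 p.1 :=
  measurable_uncurry_of_rightContinuous (Y := fun s ω => realPath X ω s)
    (fun _ => hX.measurable _) fun ω t => (hX.path ω).right_continuous t

omit [IsProbabilityMeasure P] in
theorem exp_le_one {l : ℝ} (hl : 0 ≤ l) (t : ℝ≥0) (ω : Ω) : Real.exp (-(l * X t ω)) ≤ 1 := by
  have := hX.nonneg t ω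
  exact Real.exp_le_one_iff.2 (neg_nonpos.2 (by positivity))

theorem integrable_exp {l : ℝ} (hl : 0 ≤ l) (t : ℝ≥0) :
    Integrable (fun ω => Real.exp (-(l * X t ω))) P := by
  have := hX.measurable t
  refine (integrable_const (1 : ℝ)).mono' (by fun_prop) (ae_of_all _ fun ω => ?_)
  rw [Real.norm_of_nonneg (Real.exp_pos _).le]
  exact hX.exp_le_one hl t ω

omit [IsProbabilityMeasure P] in
theorem integral_exp_increment (l : ℝ) (s t : ℝ≥0) :
    ∫ ω, Real.exp (-(l * (X (s + t) ω - X s ω))) ∂P = ∫ ω, Real.exp (-(l * X t ω)) ∂P :=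
  ((hX.stationary_increments s t).comp
    (u := fun x => Real.exp (-(l * x))) (by fun_prop)).integral_eq

theorem integral_exp_pos {l : ℝ} (hl : 0 ≤ l) (t : ℝ≥0) :
    0 < ∫ ω, Real.exp (-(l * X t ω)) ∂P :=
  MeasureTheory.integral_exp_pos (hX.integrable_exp hl t)

/-- A functional of the path up to time `a` is uncorrelated with `exp(-l (X_b - X_a))`. -/
theorem integral_mul_exp_increment {l : ℝ} {a : ℝ≥0} (h : ℝ≥0) {f : Ω → ℝ}
    (hf : Measurable[MeasurableSpace.comap (fun ω (s : Iic a) => X s ω) inferInstance] f) :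
    ∫ ω, f ω * Real.exp (-(l * (X (a + h) ω - X a ω))) ∂P =
      (∫ ω, f ω ∂P) * ∫ ω, Real.exp (-(l * X h ω)) ∂P := by
  have hind := HasIndepIncrements.indepFun_past hX.indep_increments hX.measurable hX.zero
    (le_self_add (a := a) (b := h))
  have hpast : Measurable fun ω (s : Iic a) => X s ω :=
    measurable_pi_lambda _ fun s => hX.measurable s
  have hXa := hX.measurable a
  have hXb := hX.measurable (a + h)
  have h1 : IndepFun f (fun ω => Real.exp (-(l * (X (a + h) ω - X a ω)))) P := by
    have h2 : IndepFun (fun ω (s : Iic a) => X s ω)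
        (fun ω => Real.exp (-(l * (X (a + h) ω - X a ω)))) P :=
      hind.comp measurable_id (ψ := fun x => Real.exp (-(l * x))) (by fun_prop)
    rw [IndepFun_iff_Indep] at h2 ⊢
    exact indep_of_indep_of_le_left h2 hf.comap_le
  rw [← hX.integral_exp_increment l a h]
  exact h1.integral_fun_mul_eq_mul_integral (hf.mono hpast.comap_le le_rfl).aestronglyMeasurable
    (by fun_prop)

theorem integral_exp_add (l : ℝ) (s t : ℝ≥0) :
    ∫ ω, Real.exp (-(l * X (s + t) ω)) ∂P =
      (∫ ω, Real.exp (-(l * X s ω)) ∂P) * ∫ ω, Real.exp (-(l * X t ω)) ∂P := by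
  have hs : Measurable[MeasurableSpace.comap (fun ω (r : Iic s) => X r ω) inferInstance] (X s) :=
    (measurable_pi_apply (⟨s, self_mem_Iic⟩ : Iic s)).comp
      (comap_measurable fun ω (r : Iic s) => X r ω)
  have hf : Measurable[MeasurableSpace.comap (fun ω (r : Iic s) => X r ω) inferInstance]
      fun ω => Real.exp (-(l * X s ω)) := (hs.const_mul l).neg.exp
  rw [← hX.integral_mul_exp_increment t hf]
  congr 1; ext ω
  rw [← Real.exp_add]; congr 1; ring

theorem integral_exp_eq {l : ℝ} (hl : 0 ≤ l) (t : ℝ≥0) :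
    ∫ ω, Real.exp (-(l * X t ω)) ∂P = Real.exp (-(laplaceCumulant X P l * t)) := by
  have h1 := eq_mul_of_add_nonneg (f := fun t => -Real.log (∫ ω, Real.exp (-(l * X t ω)) ∂P))
    (fun s t => by
      rw [hX.integral_exp_add, Real.log_mul (hX.integral_exp_pos hl s).ne'
        (hX.integral_exp_pos hl t).ne']
      ring)
    (fun t => by
      rw [neg_nonneg]
      refine Real.log_nonpos (hX.integral_exp_pos hl t).le ?_
      have := integral_mono (hX.integrable_exp hl t) (integrable_const (1 : ℝ))
        (hX.exp_le_one hl t)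
      simpa using this) t
  rw [laplaceCumulant, mul_comm, ← h1, neg_neg, Real.exp_log (hX.integral_exp_pos hl t)]

theorem laplaceCumulant_nonneg {l : ℝ} (hl : 0 ≤ l) : 0 ≤ laplaceCumulant X P l := by
  rw [laplaceCumulant, neg_nonneg]
  refine Real.log_nonpos (hX.integral_exp_pos hl 1).le ?_
  have := integral_mono (hX.integrable_exp hl 1) (integrable_const (1 : ℝ)) (hX.exp_le_one hl 1)
  simpa using this

theorem laplaceCumulant_mono {l m : ℝ} (hl : 0 ≤ l) (hlm : l ≤ m) :
    laplaceCumulant X P l ≤ laplaceCumulant X P m := by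
  rw [laplaceCumulant, laplaceCumulant, neg_le_neg_iff]
  refine Real.log_le_log (hX.integral_exp_pos (hl.trans hlm) 1)
    (integral_mono (hX.integrable_exp (hl.trans hlm) 1) (hX.integrable_exp hl 1) fun ω => ?_)
  have := hX.nonneg 1 ω
  dsimp only
  gcongr

/-- Cauchy–Schwarz: `E[exp(-(l+1) X)]² ≤ E[exp(-l X)] E[exp(-(l+2) X)]`, then logarithms. -/
theorem laplaceCumulant_concave {l : ℝ} (hl : 0 ≤ l) :
    laplaceCumulant X P (l + 2) - laplaceCumulant X P (l + 1) ≤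
      laplaceCumulant X P (l + 1) - laplaceCumulant X P l := by
  set a := ∫ ω, Real.exp (-(l * X 1 ω)) ∂P with ha
  set b := ∫ ω, Real.exp (-((l + 1) * X 1 ω)) ∂P with hb
  set c := ∫ ω, Real.exp (-((l + 2) * X 1 ω)) ∂P with hc
  have ha0 : 0 < a := hX.integral_exp_pos hl 1
  have hb0 : 0 < b := hX.integral_exp_pos (by positivity) 1
  have hc0 : 0 < c := hX.integral_exp_pos (by positivity) 1
  have hai := hX.integrable_exp hl 1
  have hbi := hX.integrable_exp (show 0 ≤ l + 1 by positivity) 1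
  have hci := hX.integrable_exp (show 0 ≤ l + 2 by positivity) 1
  have key : ∀ x : ℝ, 0 ≤ a * x ^ 2 - b * (2 * x) + c := by
    intro x
    have h1 : ∫ ω, Real.exp (-(l * X 1 ω)) * (x - Real.exp (-X 1 ω)) ^ 2 ∂P =
        a * x ^ 2 - b * (2 * x) + c := by
      rw [ha, hb, hc, ← integral_mul_const, ← integral_mul_const, ← integral_sub
        (hai.mul_const _) (hbi.mul_const _), ← integral_add _ hci]
      swap
      · exact (hai.mul_const _).sub (hbi.mul_const _)
      congr 1; ext ω
      have e1 : Real.exp (-((l + 1) * X 1 ω)) =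
          Real.exp (-(l * X 1 ω)) * Real.exp (-X 1 ω) := by
        rw [← Real.exp_add]; congr 1; ring
      have e2 : Real.exp (-((l + 2) * X 1 ω)) =
          Real.exp (-(l * X 1 ω)) * Real.exp (-X 1 ω) ^ 2 := by
        rw [← Real.exp_nat_mul, ← Real.exp_add]; congr 1; push_cast; ring
      rw [e1, e2]; ring
    rw [← h1]
    exact integral_nonneg fun ω => by positivity
  have h2 : b ^ 2 ≤ a * c := by
    -- The minimiser of the quadratic.
    have := key (b / a)
    have h3 : a * (b / a) ^ 2 - b * (2 * (b / a)) + c = (a * c - b ^ 2) / a := by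
      field_simp; ring
    rw [h3] at this
    by_contra! hlt
    exact absurd this (not_le.2 (div_neg_of_neg_of_pos (by linarith) ha0))
  have h4 := Real.log_le_log (by positivity) h2
  rw [Real.log_pow, Real.log_mul ha0.ne' hc0.ne'] at h4
  simp only [laplaceCumulant, ← ha, ← hb, ← hc]
  push_cast at h4
  linarith

end IsRegularSubordinator

/-! ### Part (ii): Dynkin's formula at the time change. -/

theorem measurable_discount_of_clock_lt {Ω : Type*} [MeasurableSpace Ω] {X : ℝ≥0 → Ω → ℝ}
    (hpath : ∀ ω, IsIncreasingPath (realPath X ω)) (a : ℝ≥0) (hm : ∀ s ≤ a, Measurable (X s))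
    (q l t : ℝ) : Measurable fun ω =>
      if clock (realPath X ω) a < t then discount q l (realPath X ω) a else 0 := by
  refine Measurable.ite (measurableSet_lt (measurable_clock_of_past hpath a hm)
    measurable_const) ?_ measurable_const
  have h1 := hm a le_rfl
  simp only [discount, realPath, Real.toNNReal_coe]
  fun_prop

namespace IsRegularSubordinator
variable {Ω : Type*} [MeasurableSpace Ω] {P : Measure Ω} [IsProbabilityMeasure P]
  {X : ℝ≥0 → Ω → ℝ} (hX : IsRegularSubordinator X P) {q l : ℝ} (hq : 0 ≤ q) (hl : 0 ≤ l)
include hX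

omit [IsProbabilityMeasure P] in
theorem measurable_discount (q l : ℝ) {T : Ω → ℝ} (hT : Measurable T) :
    Measurable fun ω => discount q l (realPath X ω) (T ω) := by
  have h1 : Measurable fun ω => realPath X ω (T ω) :=
    hX.measurable_realPath.comp (hT.prodMk measurable_id)
  unfold discount
  fun_prop

omit [IsProbabilityMeasure P] in
theorem measurable_clockInv {t : ℝ} (ht : 0 ≤ t) :
    Measurable fun ω => clockInv (realPath X ω) t :=
  measurable_clockInv_of_process hX.path hX.measurable ht

include hq hl

theorem integrable_discount {T : Ω → ℝ} (hT : Measurable T) (hT0 : ∀ ω, 0 ≤ T ω) :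
    Integrable (fun ω => discount q l (realPath X ω) (T ω)) P := by
  refine (integrable_const (1 : ℝ)).mono' (hX.measurable_discount q l hT).aestronglyMeasurable
    (ae_of_all _ fun ω => ?_)
  rw [discount, Real.norm_of_nonneg (Real.exp_pos _).le]
  exact (hX.path ω).discount_le_one hq hl (hT0 ω)

theorem integrable_discount_of_clock_lt (a : ℝ≥0) (b : ℝ≥0) (t : ℝ) :
    Integrable (fun ω => if clock (realPath X ω) a < t then
      discount q l (realPath X ω) b else 0) P := by
  have h1 := (hX.integrable_discount hq hl (T := fun _ => (b : ℝ)) measurable_const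
    fun _ => b.2).indicator (measurableSet_lt
      (measurable_clock_of_past hX.path a fun s _ => hX.measurable s)
      (measurable_const (a := t)))
  refine h1.congr (ae_of_all _ fun ω => ?_)
  simp [indicator]

/-- The event `clock a < t` depends on the path up to `a` only, so the discount factor over `[a, a +
h]` splits off by independence. -/
theorem integral_discount_step (a h : ℝ≥0) (t : ℝ) :
    ∫ ω, (if clock (realPath X ω) a < t then
        discount q l (realPath X ω) (a + h : ℝ≥0) - discount q l (realPath X ω) a else 0) ∂P =
      (Real.exp (-((q + laplaceCumulant X P l) * h)) - 1) *
        ∫ ω, (if clock (realPath X ω) a < t then discount q l (realPath X ω) a else 0) ∂P := by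
  set f : Ω → ℝ := fun ω =>
    if clock (realPath X ω) a < t then discount q l (realPath X ω) a else 0 with hf
  have hfi : Integrable f P := hX.integrable_discount_of_clock_lt hq hl a a t
  have hfm : Measurable[MeasurableSpace.comap (fun ω (s : Iic a) => X s ω) inferInstance] f := by
    have hs : ∀ s ≤ a,
        Measurable[MeasurableSpace.comap (fun ω (s : Iic a) => X s ω) inferInstance] (X s) :=
      fun s hs => (measurable_pi_apply (⟨s, hs⟩ : Iic a)).comp
        (comap_measurable fun ω (r : Iic a) => X r ω)
    -- The measurability statement is instantiated at the σ-algebra of the path up to `a`.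
    exact @measurable_discount_of_clock_lt Ω
      (MeasurableSpace.comap (fun ω (s : Iic a) => X s ω) inferInstance) X hX.path a hs q l t
  have h1 : ∀ ω, (if clock (realPath X ω) a < t then
      discount q l (realPath X ω) (a + h : ℝ≥0) - discount q l (realPath X ω) a else 0) =
      Real.exp (-(q * h)) * (f ω * Real.exp (-(l * (X (a + h) ω - X a ω)))) - f ω := by
    intro ω
    simp only [hf]
    split_ifs
    · congr 1
      simp only [discount, realPath, Real.toNNReal_coe]
      rw [← Real.exp_add, ← Real.exp_add]
      congr 1; push_cast; ring
    · simp
  have hgi : Integrable (fun ω => f ω * Real.exp (-(l * (X (a + h) ω - X a ω)))) P := by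
    have hXa := hX.measurable a
    have hXb := hX.measurable (a + h)
    refine hfi.mul_bdd (c := 1) (by fun_prop) (ae_of_all _ fun ω => ?_)
    rw [Real.norm_of_nonneg (Real.exp_pos _).le]
    refine Real.exp_le_one_iff.2 (neg_nonpos.2 (mul_nonneg hl (sub_nonneg.2 ?_)))
    have := (hX.path ω).monotone (show (a : ℝ) ≤ (a + h : ℝ≥0) from
      NNReal.coe_le_coe.2 le_self_add)
    simpa only [realPath, Real.toNNReal_coe] using this
  simp_rw [h1]
  rw [integral_sub (hgi.const_mul _) hfi, integral_const_mul,
    hX.integral_mul_exp_increment h hfm, hX.integral_exp_eq hl, sub_mul, one_mul, mul_left_comm,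
    ← Real.exp_add, mul_comm]
  congr 3; ring

/-- Dynkin's formula on a grid, at the first multiple of `h` not before `clockInv t`: the one-step
identities are summed over `j < N`, which is enough because `clockInv t ≤ t = N * h`. -/
theorem integral_discount_grid {t : ℝ≥0} {h : ℝ≥0} (hh : 0 < h) {N : ℕ} (hN : N * h = t) :
    ∫ ω, discount q l (realPath X ω) (⌈clockInv (realPath X ω) t / h⌉₊ * h) ∂P - 1 =
      (Real.exp (-((q + laplaceCumulant X P l) * h)) - 1) *
        ∫ ω, ∑ j ∈ Finset.range ⌈clockInv (realPath X ω) t / h⌉₊,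
          discount q l (realPath X ω) (j * h) ∂P := by
  have hh' : (0 : ℝ) < h := hh
  have hlt : ∀ ω (j : ℕ), clock (realPath X ω) ((j * h : ℝ≥0) : ℝ) < t ↔
      j < ⌈clockInv (realPath X ω) t / h⌉₊ := by
    intro ω j
    rw [Nat.lt_ceil, lt_div_iff₀ hh', (hX.path ω).lt_clockInv_iff]
    push_cast; rfl
  have hle : ∀ ω, ⌈clockInv (realPath X ω) t / h⌉₊ ≤ N := by
    intro ω
    rw [Nat.ceil_le, div_le_iff₀ hh']
    have := (hX.path ω).clockInv_le t.2
    have h2 : (t : ℝ) = N * h := by rw [← hN]; push_cast; rfl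
    exact this.trans h2.le
  have hsum : ∀ (f : ℕ → Ω → ℝ) ω,
      ∑ j ∈ Finset.range N, (if clock (realPath X ω) ((j * h : ℝ≥0) : ℝ) < t then f j ω else 0) =
      ∑ j ∈ Finset.range ⌈clockInv (realPath X ω) t / h⌉₊, f j ω := by
    intro f ω
    rw [← Finset.sum_filter]
    refine Finset.sum_congr ?_ fun _ _ => rfl
    ext j
    have := hle ω
    simp only [Finset.mem_filter, Finset.mem_range, hlt]
    lia
  have htel : ∀ ω, ∑ j ∈ Finset.range N, (if clock (realPath X ω) ((j * h : ℝ≥0) : ℝ) < t then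
      discount q l (realPath X ω) ((j * h + h : ℝ≥0) : ℝ) -
        discount q l (realPath X ω) ((j * h : ℝ≥0) : ℝ) else 0) =
      discount q l (realPath X ω) (⌈clockInv (realPath X ω) t / h⌉₊ * h) - 1 := by
    intro ω
    rw [hsum (fun j ω => discount q l (realPath X ω) ((j * h + h : ℝ≥0) : ℝ) -
        discount q l (realPath X ω) ((j * h : ℝ≥0) : ℝ))]
    have h1 := Finset.sum_range_sub (fun j : ℕ => discount q l (realPath X ω) (j * h))
      ⌈clockInv (realPath X ω) t / h⌉₊
    have h0 : discount q l (realPath X ω) ((0 : ℕ) * h) = 1 := by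
      simp [discount, (hX.path ω).eq_zero 0 le_rfl]
    rw [h0] at h1
    rw [← h1]
    refine Finset.sum_congr rfl fun j _ => ?_
    push_cast
    rw [add_mul, one_mul]
  have hint : ∀ j b : ℝ≥0, _ := fun j b => hX.integrable_discount_of_clock_lt hq hl j b t
  have hintd : ∀ j : ℕ, Integrable (fun ω =>
      if clock (realPath X ω) ((j * h : ℝ≥0) : ℝ) < t then
      discount q l (realPath X ω) ((j * h + h : ℝ≥0) : ℝ) -
        discount q l (realPath X ω) ((j * h : ℝ≥0) : ℝ) else 0) P := by
    intro j
    refine ((hint (j * h) (j * h + h)).sub (hint (j * h) (j * h))).congr (ae_of_all _ fun ω => ?_)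
    simp only [Pi.sub_apply]
    split_ifs <;> simp
  have hmeasT : Measurable fun ω => (⌈clockInv (realPath X ω) t / h⌉₊ * h : ℝ) := by
    have := hX.measurable_clockInv t.2
    have h2 : Measurable fun ω => ⌈clockInv (realPath X ω) t / h⌉₊ :=
      Nat.measurable_ceil.comp (this.div_const _)
    exact ((measurable_from_top (f := fun n : ℕ => (n : ℝ))).comp h2).mul_const _
  have hL : ∫ ω, discount q l (realPath X ω) (⌈clockInv (realPath X ω) t / h⌉₊ * h) ∂P - 1 =
      ∫ ω, ∑ j ∈ Finset.range N, (if clock (realPath X ω) ((j * h : ℝ≥0) : ℝ) < t then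
      discount q l (realPath X ω) ((j * h + h : ℝ≥0) : ℝ) -
        discount q l (realPath X ω) ((j * h : ℝ≥0) : ℝ) else 0) ∂P := by
    simp_rw [htel]
    rw [integral_sub (hX.integrable_discount hq hl hmeasT fun ω => by positivity)
      (integrable_const _)]
    simp
  have hR : ∫ ω, ∑ j ∈ Finset.range ⌈clockInv (realPath X ω) t / h⌉₊,
      discount q l (realPath X ω) (j * h) ∂P =
      ∫ ω, ∑ j ∈ Finset.range N, (if clock (realPath X ω) ((j * h : ℝ≥0) : ℝ) < t then
        discount q l (realPath X ω) ((j * h : ℝ≥0) : ℝ) else 0) ∂P := by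
    congr 1; ext ω
    rw [hsum (fun j ω => discount q l (realPath X ω) ((j * h : ℝ≥0) : ℝ))]
    simp
  rw [hL, hR, integral_finsetSum _ fun j _ => hintd j, integral_finsetSum _ fun j _ => hint _ _,
    Finset.mul_sum]
  exact Finset.sum_congr rfl fun j _ => hX.integral_discount_step hq hl _ _ _

omit [IsProbabilityMeasure P] hq hl in
theorem measurable_discount_clockInv (q l : ℝ) :
    Measurable fun p : ℝ × Ω => discount q l (realPath X p.2) (clockInv (realPath X p.2) (max p.1 0)) := by
  have h1 : Measurable fun p : ℝ × Ω => clockInv (realPath X p.2) (max p.1 0) :=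
    measurable_uncurry_of_rightContinuous
      (Y := fun s ω => clockInv (realPath X ω) (max s 0))
      (fun t => hX.measurable_clockInv (le_max_right _ _)) fun ω t =>
        ((hX.path ω).continuous_clockInv.comp (continuous_id.max continuous_const)).continuousWithinAt
  have h2 : Measurable fun p : ℝ × Ω => realPath X p.2 (clockInv (realPath X p.2) (max p.1 0)) :=
    hX.measurable_realPath.comp (h1.prodMk measurable_snd)
  unfold discount
  fun_prop

theorem integral_integral_discount {t : ℝ} (ht : 0 ≤ t) :
    ∫ ω, (∫ u in (0 : ℝ)..clockInv (realPath X ω) t, discount q l (realPath X ω) u) ∂P =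
      ∫ s in (0 : ℝ)..t, ∫ ω, discount q (l + 1) (realPath X ω) (clockInv (realPath X ω) s) ∂P := by
  have hl1 : 0 ≤ l + 1 := by positivity
  simp_rw [fun ω => (hX.path ω).integral_discount_clockInv hq hl ht]
  have hcongr : ∀ ω, ∫ s in (0 : ℝ)..t, discount q (l + 1) (realPath X ω) (clockInv (realPath X ω) s) =
      ∫ s in (0 : ℝ)..t, discount q (l + 1) (realPath X ω) (clockInv (realPath X ω) (max s 0)) := by
    intro ω
    refine intervalIntegral.integral_congr fun s hs => ?_
    rw [uIcc_of_le ht] at hs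
    simp only [max_eq_left hs.1]
  have hcongr2 : ∫ s in (0 : ℝ)..t, ∫ ω, discount q (l + 1) (realPath X ω) (clockInv (realPath X ω) s) ∂P =
      ∫ s in (0 : ℝ)..t, ∫ ω,
        discount q (l + 1) (realPath X ω) (clockInv (realPath X ω) (max s 0)) ∂P := by
    refine intervalIntegral.integral_congr fun s hs => ?_
    rw [uIcc_of_le ht] at hs
    simp only [max_eq_left hs.1]
  simp_rw [hcongr, hcongr2, intervalIntegral.integral_of_le ht]
  rw [integral_integral_swap]
  refine (integrable_const (1 : ℝ)).mono'
    ((hX.measurable_discount_clockInv q (l + 1)).comp measurable_swap).aestronglyMeasurable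
    (ae_of_all _ fun p => ?_)
  simp only [Function.uncurry]
  rw [discount, Real.norm_of_nonneg (Real.exp_pos _).le]
  exact (hX.path _).discount_le_one hq hl1 ((hX.path _).clockInv_nonneg (le_max_right _ _))

theorem integrable_integral_discount {t : ℝ} (ht : 0 ≤ t) :
    Integrable (fun ω => ∫ u in (0 : ℝ)..clockInv (realPath X ω) t,
      discount q l (realPath X ω) u) P := by
  have hl1 : 0 ≤ l + 1 := by positivity
  have hcongr : ∀ ω, ∫ u in (0 : ℝ)..clockInv (realPath X ω) t, discount q l (realPath X ω) u =
      ∫ s in Ioc 0 t, discount q (l + 1) (realPath X ω) (clockInv (realPath X ω) (max s 0)) := by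
    intro ω
    rw [(hX.path ω).integral_discount_clockInv hq hl ht, intervalIntegral.integral_of_le ht]
    refine setIntegral_congr_fun measurableSet_Ioc fun s hs => ?_
    simp only [max_eq_left hs.1.le]
  simp_rw [hcongr]
  refine Integrable.integral_prod_left (μ := P) (ν := volume.restrict (Ioc 0 t))
    (f := fun p : Ω × ℝ => discount q (l + 1) (realPath X p.1) (clockInv (realPath X p.1) (max p.2 0))) ?_
  refine (integrable_const (1 : ℝ)).mono'
    ((hX.measurable_discount_clockInv q (l + 1)).comp measurable_swap).aestronglyMeasurable
    (ae_of_all _ fun p => ?_)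
  rw [discount, Real.norm_of_nonneg (Real.exp_pos _).le]
  exact (hX.path _).discount_le_one hq hl1 ((hX.path _).clockInv_nonneg (le_max_right _ _))

/-- The mesh of the grid formula is sent to `0`: the grid times approach `clockInv t` from the
right, the sums become integrals, and `(exp(-φ h) - 1) / h` tends to `-φ`. -/
theorem integral_discount_clockInv_of_pos {t : ℝ≥0} (ht : 0 < t) :
    ∫ ω, discount q l (realPath X ω) (clockInv (realPath X ω) t) ∂P =
      1 - (q + laplaceCumulant X P l) *
        ∫ ω, (∫ u in (0 : ℝ)..clockInv (realPath X ω) t, discount q l (realPath X ω) u) ∂P := by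
  set φ := q + laplaceCumulant X P l with hφ
  let h : ℕ → ℝ≥0 := fun N => t / (N + 1)
  have hh : ∀ N, 0 < h N := fun N => by positivity
  have hh' : ∀ N, (0 : ℝ) < h N := fun N => hh N
  have hNt : ∀ N : ℕ, ((N + 1 : ℕ) : ℝ≥0) * h N = t := fun N => by
    simp only [h]; push_cast; field_simp
  have hlim0 : Tendsto (fun N => (h N : ℝ)) atTop (𝓝 0) := by
    have := (tendsto_one_div_add_atTop_nhds_zero_nat (𝕜 := ℝ)).const_mul (t : ℝ)
    rw [mul_zero] at this
    refine this.congr fun N => ?_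
    simp only [h]; push_cast; ring
  have hgrid := fun N => hX.integral_discount_grid hq hl (hh N) (hNt N)
  have hτ0 : ∀ ω, 0 ≤ clockInv (realPath X ω) t := fun ω => (hX.path ω).clockInv_nonneg t.2
  have hTlow : ∀ N ω, clockInv (realPath X ω) t ≤ ⌈clockInv (realPath X ω) t / h N⌉₊ * h N :=
    fun N ω => (div_le_iff₀ (hh' N)).1 (Nat.le_ceil _)
  have hTup : ∀ N ω, ((⌈clockInv (realPath X ω) t / h N⌉₊ : ℝ) - 1) * h N ≤
      clockInv (realPath X ω) t := fun N ω => by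
    rw [← le_div_iff₀ (hh' N)]
    have := Nat.ceil_lt_add_one (div_nonneg (hτ0 ω) (hh' N).le)
    linarith
  have hmeasT : ∀ N, Measurable fun ω => (⌈clockInv (realPath X ω) t / h N⌉₊ * h N : ℝ) := by
    intro N
    have h2 : Measurable fun ω => ⌈clockInv (realPath X ω) t / h N⌉₊ :=
      Nat.measurable_ceil.comp ((hX.measurable_clockInv t.2).div_const _)
    exact ((measurable_from_top (f := fun n : ℕ => (n : ℝ))).comp h2).mul_const _
  have hlimZ : Tendsto (fun N => ∫ ω, discount q l (realPath X ω)
      (⌈clockInv (realPath X ω) t / h N⌉₊ * h N) ∂P) atTop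
      (𝓝 (∫ ω, discount q l (realPath X ω) (clockInv (realPath X ω) t) ∂P)) := by
    refine tendsto_integral_of_dominated_convergence (fun _ => (1 : ℝ))
      (fun N => (hX.measurable_discount q l (hmeasT N)).aestronglyMeasurable)
      (integrable_const _) (fun N => ae_of_all _ fun ω => ?_) (ae_of_all _ fun ω => ?_)
    · rw [discount, Real.norm_of_nonneg (Real.exp_pos _).le]
      exact (hX.path ω).discount_le_one hq hl (by positivity)
    · refine ((hX.path ω).rightContinuous_discount _).tendsto.comp
        (tendsto_nhdsWithin_iff.2 ⟨?_, Eventually.of_forall fun N => hTlow N ω⟩)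
      have hl2 := hlim0.const_add (clockInv (realPath X ω) t)
      rw [add_zero] at hl2
      refine tendsto_of_tendsto_of_tendsto_of_le_of_le tendsto_const_nhds hl2
        (fun N => hTlow N ω) fun N => ?_
      have := hTup N ω
      dsimp only
      linarith
  have hlimS : Tendsto (fun N => ∫ ω, h N * ∑ j ∈ Finset.range ⌈clockInv (realPath X ω) t / h N⌉₊,
      discount q l (realPath X ω) (j * h N) ∂P) atTop
      (𝓝 (∫ ω, (∫ u in (0 : ℝ)..clockInv (realPath X ω) t, discount q l (realPath X ω) u) ∂P)) := by
    have hclose : ∀ N ω, |h N * ∑ j ∈ Finset.range ⌈clockInv (realPath X ω) t / h N⌉₊,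
        discount q l (realPath X ω) (j * h N) -
        ∫ u in (0 : ℝ)..clockInv (realPath X ω) t, discount q l (realPath X ω) u| ≤ h N :=
      fun N ω => Antitone.abs_sum_sub_integral_le ((hX.path ω).antitone_discount hq hl)
        (fun u => (Real.exp_pos _).le) ((hX.path ω).discount_le_one hq hl le_rfl) (hh' N)
        (hTlow N ω) (hτ0 ω) (hTup N ω)
    have hmeasS : ∀ N, Measurable fun ω => (h N : ℝ) *
        ∑ j ∈ Finset.range ⌈clockInv (realPath X ω) t / h N⌉₊,
          discount q l (realPath X ω) (j * h N) := by
      intro N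
      have h2 : Measurable fun ω => ⌈clockInv (realPath X ω) t / h N⌉₊ :=
        Nat.measurable_ceil.comp ((hX.measurable_clockInv t.2).div_const _)
      have h3 : Measurable fun p : ℕ × Ω =>
          ∑ j ∈ Finset.range p.1, discount q l (realPath X p.2) (j * h N) :=
        measurable_from_prod_countable_right fun n =>
          Finset.measurable_sum (Finset.range n) fun j _ =>
            hX.measurable_discount q l (T := fun _ => (j * h N : ℝ)) measurable_const
      exact (h3.comp (h2.prodMk measurable_id)).const_mul _
    have hI := hX.integrable_integral_discount hq hl (t := t) t.2
    have hintS : ∀ N, Integrable (fun ω => (h N : ℝ) *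
        ∑ j ∈ Finset.range ⌈clockInv (realPath X ω) t / h N⌉₊,
          discount q l (realPath X ω) (j * h N)) P := by
      intro N
      have h4 : Integrable (fun ω => (h N : ℝ) *
        ∑ j ∈ Finset.range ⌈clockInv (realPath X ω) t / h N⌉₊,
          discount q l (realPath X ω) (j * h N) -
        ∫ u in (0 : ℝ)..clockInv (realPath X ω) t, discount q l (realPath X ω) u) P :=
        (integrable_const (h N : ℝ)).mono' ((hmeasS N).aestronglyMeasurable.sub hI.1)
          (ae_of_all _ fun ω => hclose N ω)
      refine (h4.add hI).congr (ae_of_all _ fun ω => ?_)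
      simp
    refine tendsto_iff_norm_sub_tendsto_zero.2 (squeeze_zero (fun _ => norm_nonneg _) (fun N => ?_)
      hlim0)
    rw [← integral_sub (hintS N) hI]
    refine (norm_integral_le_of_norm_le (integrable_const (h N : ℝ))
      (ae_of_all _ fun ω => hclose N ω)).trans ?_
    simp
  have hlimφ : Tendsto (fun N => (Real.exp (-(φ * h N)) - 1) / h N) atTop (𝓝 (-φ)) := by
    have hd : HasDerivAt (fun x : ℝ => Real.exp (-(φ * x))) (-φ) 0 := by
      have := (((hasDerivAt_id (0 : ℝ)).const_mul φ).neg).exp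
      simpa using this
    have := hd.tendsto_slope_zero_right.comp
      (tendsto_nhdsWithin_iff.2 ⟨hlim0, Eventually.of_forall hh'⟩)
    refine this.congr fun N => ?_
    simp [div_eq_inv_mul]
  have hfin : Tendsto (fun N => ∫ ω, discount q l (realPath X ω)
      (⌈clockInv (realPath X ω) t / h N⌉₊ * h N) ∂P - 1) atTop
      (𝓝 (-φ * ∫ ω, (∫ u in (0 : ℝ)..clockInv (realPath X ω) t,
        discount q l (realPath X ω) u) ∂P)) := by
    refine (hlimφ.mul hlimS).congr fun N => ?_
    rw [hgrid, integral_const_mul, ← mul_assoc, div_mul_cancel₀ _ (hh' N).ne']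
  have := tendsto_nhds_unique hfin (hlimZ.sub_const 1)
  linarith

end IsRegularSubordinator

/-! ### The survival function and the effect of killing. -/

namespace IsRegularSubordinator
variable {Ω : Type*} [MeasurableSpace Ω] {P : Measure Ω} [IsProbabilityMeasure P]
  {X : ℝ≥0 → Ω → ℝ} (hX : IsRegularSubordinator X P)
include hX

section survival
variable {q l : ℝ} (hq : 0 ≤ q) (hl : 0 ≤ l)
include hq hl

theorem integral_discount_clockInv_eq {t : ℝ} (ht : 0 ≤ t) :
    ∫ ω, discount q l (realPath X ω) (clockInv (realPath X ω) t) ∂P =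
      1 - (q + laplaceCumulant X P l) * ∫ s in (0 : ℝ)..t,
        ∫ ω, discount q (l + 1) (realPath X ω) (clockInv (realPath X ω) s) ∂P := by
  rcases eq_or_lt_of_le ht with rfl | hpos
  · have h1 : ∀ ω, discount q l (realPath X ω) (clockInv (realPath X ω) 0) = 1 := fun ω => by
      simp [(hX.path ω).clockInv_zero, discount, (hX.path ω).eq_zero 0 le_rfl]
    simp [h1]
  · rw [← hX.integral_integral_discount hq hl ht]
    exact hX.integral_discount_clockInv_of_pos hq hl (t := ⟨t, ht⟩) hpos

theorem antitoneOn_integral_discount_clockInv : AntitoneOn (fun t =>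
    ∫ ω, discount q l (realPath X ω) (clockInv (realPath X ω) t) ∂P) (Ici 0) := by
  intro s hs t ht hst
  refine integral_mono (hX.integrable_discount hq hl (hX.measurable_clockInv ht)
    fun ω => (hX.path ω).clockInv_nonneg ht) (hX.integrable_discount hq hl
    (hX.measurable_clockInv hs) fun ω => (hX.path ω).clockInv_nonneg hs) fun ω => ?_
  exact (hX.path ω).antitone_discount hq hl ((hX.path ω).strictMono_clockInv.monotone hst)

omit [IsProbabilityMeasure P] hX hq hl in
theorem integral_discount_clockInv_nonneg (q l t : ℝ) :
    0 ≤ ∫ ω, discount q l (realPath X ω) (clockInv (realPath X ω) t) ∂P :=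
  integral_nonneg fun _ => (Real.exp_pos _).le

theorem integral_discount_clockInv_le_one {t : ℝ} (ht : 0 ≤ t) :
    ∫ ω, discount q l (realPath X ω) (clockInv (realPath X ω) t) ∂P ≤ 1 := by
  have := integral_mono (hX.integrable_discount hq hl (hX.measurable_clockInv ht)
    fun ω => (hX.path ω).clockInv_nonneg ht) (integrable_const (1 : ℝ))
    fun ω => (hX.path ω).discount_le_one hq hl ((hX.path ω).clockInv_nonneg ht)
  simpa using this

/-- Paths may jump, but the expectation is one minus a multiple of the primitive of a monotone
function. -/
theorem continuousOn_integral_discount_clockInv : ContinuousOn (fun t =>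
    ∫ ω, discount q l (realPath X ω) (clockInv (realPath X ω) t) ∂P) (Ici 0) := by
  have hint : ∀ b, 0 ≤ b → IntervalIntegrable (fun s =>
      ∫ ω, discount q (l + 1) (realPath X ω) (clockInv (realPath X ω) s) ∂P) volume 0 b := by
    intro b hb
    refine AntitoneOn.intervalIntegrable
      ((hX.antitoneOn_integral_discount_clockInv hq (by positivity)).mono ?_)
    rw [uIcc_of_le hb]; exact Icc_subset_Ici_self
  refine ContinuousOn.congr ?_ fun t ht => hX.integral_discount_clockInv_eq hq hl ht
  refine continuousOn_const.sub (continuousOn_const.mul fun t ht => ?_)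
  have ht' : (0 : ℝ) ≤ t := ht
  have h1 : ContinuousOn (fun t => ∫ s in (0 : ℝ)..t,
      ∫ ω, discount q (l + 1) (realPath X ω) (clockInv (realPath X ω) s) ∂P)
      (uIcc 0 (t + 1)) :=
    intervalIntegral.continuousOn_primitive_interval'
      (hint _ (by positivity)) left_mem_uIcc
  rw [uIcc_of_le (by positivity)] at h1
  refine (h1 t ⟨ht', by linarith⟩).mono_of_mem_nhdsWithin ?_
  rw [← Ici_inter_Iic]
  exact inter_mem_nhdsWithin _ (Iic_mem_nhds (by linarith))

theorem hasDerivAt_integral_discount_clockInv {t : ℝ} (ht : 0 < t) :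
    HasDerivAt (fun t => ∫ ω, discount q l (realPath X ω) (clockInv (realPath X ω) t) ∂P)
      (-((q + laplaceCumulant X P l) *
        ∫ ω, discount q (l + 1) (realPath X ω) (clockInv (realPath X ω) t) ∂P)) t := by
  have hc := hX.continuousOn_integral_discount_clockInv hq (show 0 ≤ l + 1 by positivity)
  have hsub : uIcc 0 t ⊆ Ici 0 := by rw [uIcc_of_le ht.le]; exact Icc_subset_Ici_self
  have h1 := intervalIntegral.integral_hasDerivAt_right ((hc.mono hsub).intervalIntegrable)
    ((hc.mono Ioi_subset_Ici_self).stronglyMeasurableAtFilter isOpen_Ioi t ht)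
    (hc.continuousAt (Ici_mem_nhds ht))
  refine HasDerivAt.congr_of_eventuallyEq ((h1.const_mul _).const_sub 1) ?_
  filter_upwards [Ioi_mem_nhds ht] with s hs
  exact hX.integral_discount_clockInv_eq hq hl (le_of_lt hs)

end survival

section killed
variable {ζ : Ω → ℝ} {q : ℝ} (hq : 0 < q) (hζm : Measurable ζ) (hζ : HasLaw ζ (expMeasure q) P)
  (hind : IndepFun (fun ω t => X t ω) ζ P)
include hq hζ

omit [IsProbabilityMeasure P] hX in
theorem measure_lt_lifetime {t : ℝ} (ht : 0 ≤ t) :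
    P {ω | t < ζ ω} = ENNReal.ofReal (Real.exp (-(q * t))) := by
  rw [← expMeasure_Ioi hq ht, hζ.measure_eq (p := fun x => t < x) measurableSet_Ioi]
  rfl

include hind hζm

omit hX hind in
theorem measure_lt_lifetime_of_indepFun {T : Ω → ℝ} (hT : Measurable T) (hT0 : ∀ ω, 0 ≤ T ω)
    (hTζ : IndepFun T ζ P) :
    P {ω | T ω < ζ ω} = ∫⁻ ω, ENNReal.ofReal (Real.exp (-(q * T ω))) ∂P := by
  have := isProbabilityMeasure_expMeasure hq
  have h1 := (indepFun_iff_map_prod_eq_prod_map_map hT.aemeasurable hζm.aemeasurable).1 hTζ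
  have hs : MeasurableSet {p : ℝ × ℝ | p.1 < p.2} := measurableSet_lt measurable_fst measurable_snd
  calc P {ω | T ω < ζ ω} = P.map (fun ω => (T ω, ζ ω)) {p : ℝ × ℝ | p.1 < p.2} := by
        rw [Measure.map_apply (hT.prodMk hζm) hs]; rfl
    _ = ∫⁻ ω, expMeasure q (Ioi (T ω)) ∂P := by
        rw [h1, hζ.map_eq, Measure.prod_apply hs, lintegral_map (measurable_measure_prodMk_left hs) hT]
        rfl
    _ = _ := lintegral_congr fun ω => expMeasure_Ioi hq (hT0 ω)

omit [IsProbabilityMeasure P] hq hζm hζ in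
theorem indepFun_clockInv {t : ℝ} (ht : 0 ≤ t) :
    IndepFun (fun ω => clockInv (realPath X ω) t) ζ P := by
  have h1 : Measurable[MeasurableSpace.comap (fun ω t => X t ω) inferInstance]
      fun ω => clockInv (realPath X ω) t :=
    @measurable_clockInv_of_process Ω (MeasurableSpace.comap (fun ω t => X t ω) inferInstance) X
      hX.path (fun s => (measurable_pi_apply s).comp (comap_measurable fun ω t => X t ω)) t ht
  rw [IndepFun_iff_Indep] at hind ⊢
  exact indep_of_indep_of_le_left hind h1.comap_le

/-- Inverting the clock turns the event into `clockInv t < ζ`, where `ζ` is exponential and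
independent of the path. The maximum with `0` covers the null set on which `ζ` is negative. -/
theorem measure_lt_clock_lifetime {t : ℝ} (ht : 0 ≤ t) :
    P {ω | t < clock (realPath X ω) (max (ζ ω) 0)} =
      ENNReal.ofReal (∫ ω, discount q 0 (realPath X ω) (clockInv (realPath X ω) t) ∂P) := by
  have hset : {ω | t < clock (realPath X ω) (max (ζ ω) 0)} =
      {ω | clockInv (realPath X ω) t < ζ ω} := by
    ext ω
    have h1 : t < clock (realPath X ω) (max (ζ ω) 0) ↔
        clockInv (realPath X ω) t < max (ζ ω) 0 := by
      rw [← (hX.path ω).strictMono_clock.lt_iff_lt (a := clockInv (realPath X ω) t),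
        (hX.path ω).clock_clockInv]
    have h2 := (hX.path ω).clockInv_nonneg ht
    simp only [mem_ofPred_eq, h1, lt_max_iff, or_iff_left (not_lt.2 h2)]
  rw [hset, measure_lt_lifetime_of_indepFun hq hζm hζ (hX.measurable_clockInv ht)
    (fun ω => (hX.path ω).clockInv_nonneg ht) (hX.indepFun_clockInv hind ht),
    ofReal_integral_eq_lintegral_ofReal (hX.integrable_discount hq.le le_rfl
      (hX.measurable_clockInv ht) fun ω => (hX.path ω).clockInv_nonneg ht)
      (ae_of_all _ fun _ => (Real.exp_pos _).le)]
  simp [discount]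

omit [IsProbabilityMeasure P] hq hζ hind in
theorem measurable_clock_lifetime : Measurable fun ω => clock (realPath X ω) (max (ζ ω) 0) := by
  have h1 : Measurable fun p : ℝ × Ω => clock (realPath X p.2) (max p.1 0) :=
    measurable_uncurry_of_rightContinuous
      (Y := fun s ω => clock (realPath X ω) (max s 0))
      (fun t => measurable_clock_of_past hX.path ⟨max t 0, le_max_right _ _⟩
        fun s _ => hX.measurable s) fun ω t =>
        ((hX.path ω).continuous_clock.comp (continuous_id.max continuous_const)).continuousWithinAt
  exact h1.comp (hζm.prodMk measurable_id)

theorem laplaceExponent_eq {l : ℝ} (hl : 0 ≤ l) :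
    laplaceExponent X ζ P l = q + laplaceCumulant X P l := by
  have hXm := hX.measurable 1
  have h1 : IndepFun (fun ω => Real.exp (-(l * X 1 ω)))
      (fun ω => (Ioi (1 : ℝ)).indicator (fun _ => (1 : ℝ)) (ζ ω)) P :=
    (hind.comp (measurable_pi_apply 1) measurable_id).comp
      (φ := fun x => Real.exp (-(l * x))) (ψ := (Ioi (1 : ℝ)).indicator fun _ => (1 : ℝ))
      (by fun_prop) (measurable_const.indicator measurableSet_Ioi)
  have hset : MeasurableSet {ω | 1 < ζ ω} := measurableSet_lt measurable_const hζm
  have h2 : ∫ ω in {ω | 1 < ζ ω}, Real.exp (-l * X 1 ω) ∂P =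
      ∫ ω, Real.exp (-(l * X 1 ω)) * (Ioi (1 : ℝ)).indicator (fun _ => (1 : ℝ)) (ζ ω) ∂P := by
    rw [← integral_indicator hset]
    congr 1; ext ω
    by_cases h : 1 < ζ ω <;> simp [indicator, h]
  have h3 : ∫ ω, (Ioi (1 : ℝ)).indicator (fun _ => (1 : ℝ)) (ζ ω) ∂P = Real.exp (-q) := by
    have : (fun ω => (Ioi (1 : ℝ)).indicator (fun _ => (1 : ℝ)) (ζ ω)) =
        {ω | 1 < ζ ω}.indicator fun _ => (1 : ℝ) := by
      ext ω; by_cases h : 1 < ζ ω <;> simp [indicator, h]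
    rw [this, integral_indicator hset, setIntegral_const, smul_eq_mul, mul_one, Measure.real,
      measure_lt_lifetime hq hζ zero_le_one, ENNReal.toReal_ofReal (Real.exp_pos _).le, mul_one]
  rw [laplaceExponent, h2, h1.integral_fun_mul_eq_mul_integral (by fun_prop)
    ((measurable_const.indicator measurableSet_Ioi).comp hζm).aestronglyMeasurable, h3,
    Real.log_mul (hX.integral_exp_pos hl 1).ne' (Real.exp_pos _).ne', Real.log_exp,
    laplaceCumulant]
  ring

/-- At time `t ≥ 0` the integrand has mean `exp(-(q + laplaceCumulant X P l) t)`, an exponential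
density up to its normalising constant. -/
theorem lintegral_exp_potentialMeasure {l : ℝ} (hl : 0 ≤ l) :
    ∫⁻ y, ENNReal.ofReal (Real.exp (-(l * y))) ∂(potentialMeasure X ζ P) =
      ENNReal.ofReal (q + laplaceCumulant X P l)⁻¹ := by
  set φ := q + laplaceCumulant X P l with hφ
  have hφ0 : 0 < φ := add_pos_of_pos_of_nonneg hq (hX.laplaceCumulant_nonneg hl)
  have hE : MeasurableSet {p : Ω × ℝ | 0 ≤ p.2 ∧ p.2 < ζ p.1} :=
    (measurableSet_le measurable_const measurable_snd).inter
      (measurableSet_lt measurable_snd (hζm.comp measurable_fst))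
  have hXm : Measurable fun p : Ω × ℝ => X p.2.toNNReal p.1 :=
    hX.measurable_realPath.comp measurable_swap
  have hfm : Measurable fun p : Ω × ℝ => ENNReal.ofReal (Real.exp (-(l * X p.2.toNNReal p.1))) :=
    (hXm.const_mul l).neg.exp.ennreal_ofReal
  rw [potentialMeasure, lintegral_map (by fun_prop) hXm, ← lintegral_indicator hE,
    lintegral_prod_symm' _ (hfm.indicator hE)]
  have hinner : ∀ t : ℝ, ENNReal.ofReal φ * ∫⁻ ω, {p : Ω × ℝ | 0 ≤ p.2 ∧ p.2 < ζ p.1}.indicator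
      (fun p => ENNReal.ofReal (Real.exp (-(l * X p.2.toNNReal p.1)))) (ω, t) ∂P =
      exponentialPDF φ t := by
    intro t
    rcases lt_or_ge t 0 with ht | ht
    · rw [exponentialPDF_of_neg ht]
      simp [indicator, not_le.2 ht]
    · have hXt := hX.measurable t.toNNReal
      have h1 : ∀ ω, {p : Ω × ℝ | 0 ≤ p.2 ∧ p.2 < ζ p.1}.indicator
          (fun p => ENNReal.ofReal (Real.exp (-(l * X p.2.toNNReal p.1)))) (ω, t) =
          ENNReal.ofReal (Real.exp (-(l * X t.toNNReal ω))) *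
            (Ioi t).indicator (fun _ => (1 : ℝ≥0∞)) (ζ ω) := by
        intro ω
        by_cases h : t < ζ ω <;> simp [indicator, ht, h]
      have h2 : IndepFun (fun ω => ENNReal.ofReal (Real.exp (-(l * X t.toNNReal ω))))
          (fun ω => (Ioi t).indicator (fun _ => (1 : ℝ≥0∞)) (ζ ω)) P :=
        (hind.comp (measurable_pi_apply t.toNNReal) measurable_id).comp
          (φ := fun x => ENNReal.ofReal (Real.exp (-(l * x))))
          (ψ := (Ioi t).indicator fun _ => (1 : ℝ≥0∞))
          (by fun_prop) (measurable_const.indicator measurableSet_Ioi)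
      have h3 : ∫⁻ ω, (Ioi t).indicator (fun _ => (1 : ℝ≥0∞)) (ζ ω) ∂P =
          ENNReal.ofReal (Real.exp (-(q * t))) := by
        have : (fun ω => (Ioi t).indicator (fun _ => (1 : ℝ≥0∞)) (ζ ω)) =
            {ω | t < ζ ω}.indicator fun _ => (1 : ℝ≥0∞) := by
          ext ω; by_cases h : t < ζ ω <;> simp [indicator, h]
        rw [this, lintegral_indicator (measurableSet_lt measurable_const hζm), setLIntegral_const,
          one_mul, measure_lt_lifetime hq hζ ht]
      have hζi : Measurable fun ω => (Ioi t).indicator (fun _ => (1 : ℝ≥0∞)) (ζ ω) :=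
        (measurable_const.indicator measurableSet_Ioi).comp hζm
      simp_rw [h1]
      rw [lintegral_mul_eq_lintegral_mul_lintegral_of_indepFun'' (by fun_prop)
        hζi.aemeasurable h2, h3,
        ← ofReal_integral_eq_lintegral_ofReal (hX.integrable_exp hl _)
          (ae_of_all _ fun _ => (Real.exp_pos _).le), hX.integral_exp_eq hl,
        exponentialPDF_of_nonneg ht, ← ENNReal.ofReal_mul (Real.exp_pos _).le,
        ← ENNReal.ofReal_mul hφ0.le, ← Real.exp_add, Real.coe_toNNReal t ht]
      congr 3
      rw [hφ]; ring
  have hmul : ENNReal.ofReal φ * ∫⁻ t, ∫⁻ ω, {p : Ω × ℝ | 0 ≤ p.2 ∧ p.2 < ζ p.1}.indicator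
      (fun p => ENNReal.ofReal (Real.exp (-(l * X p.2.toNNReal p.1)))) (ω, t) ∂P = 1 := by
    rw [← lintegral_exponentialPDF_eq_one hφ0, ← lintegral_const_mul']
    · exact lintegral_congr hinner
    · exact ENNReal.ofReal_ne_top
  rw [ENNReal.ofReal_inv_of_pos hφ0]
  exact ENNReal.eq_inv_of_mul_eq_one_left (by rw [mul_comm]; exact hmul)

end killed

end IsRegularSubordinator

/-! ### Uniqueness of the residual law and assembly. -/

namespace IsResidualLaw
variable {φ : ℝ → ℝ} {ρ ρ' : Measure ℝ}

theorem eq (hρ : IsResidualLaw φ ρ) (hρ' : IsResidualLaw φ ρ') (hpos : ∀ n : ℕ, 0 < φ n)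
    (hconc : ∀ n : ℕ, φ (n + 2 : ℕ) - φ (n + 1 : ℕ) ≤ φ (n + 1 : ℕ) - φ n) : ρ = ρ' := by
  have := hρ.isProbabilityMeasure
  have := hρ'.isProbabilityMeasure
  refine Measure.ext_of_moments hρ.nonneg hρ'.nonneg hρ.integrable hρ'.integrable (K := 1)
    (C := max (φ (0 + 1 : ℕ)) (φ (1 + 1 : ℕ) - φ (0 + 1 : ℕ))) (lt_max_of_lt_left (hpos _))
    (fun n => ?_) fun n => by rw [hρ.moment, hρ'.moment]
  rw [hρ.moment, one_mul, prod_Icc_one_eq_prod_range]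
  exact prod_le_factorial_of_concave (φ := fun n : ℕ => φ (n + 1 : ℕ)) (fun n => hpos _)
    (fun n => hconc (n + 1)) n

end IsResidualLaw

namespace IsRegularSubordinator
variable {Ω : Type*} [MeasurableSpace Ω] {P : Measure Ω} [IsProbabilityMeasure P]
  {X : ℝ≥0 → Ω → ℝ} (hX : IsRegularSubordinator X P)
  {ζ : Ω → ℝ} {q : ℝ} (hq : 0 < q) (hζm : Measurable ζ) (hζ : HasLaw ζ (expMeasure q) P)
  (hind : IndepFun (fun ω t => X t ω) ζ P)
include hX hq hζm hζ hind

theorem laplaceExponent_pos (n : ℕ) : 0 < laplaceExponent X ζ P n := by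
  rw [hX.laplaceExponent_eq hq hζm hζ hind n.cast_nonneg]
  exact add_pos_of_pos_of_nonneg hq (hX.laplaceCumulant_nonneg n.cast_nonneg)

theorem laplaceExponent_monotone : Monotone fun n : ℕ => laplaceExponent X ζ P n := by
  intro m n h
  simp only [hX.laplaceExponent_eq hq hζm hζ hind (Nat.cast_nonneg _)]
  gcongr
  exact hX.laplaceCumulant_mono m.cast_nonneg (Nat.cast_le.2 h)

theorem laplaceExponent_concave (n : ℕ) :
    laplaceExponent X ζ P (n + 2 : ℕ) - laplaceExponent X ζ P (n + 1 : ℕ) ≤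
      laplaceExponent X ζ P (n + 1 : ℕ) - laplaceExponent X ζ P n := by
  simp only [hX.laplaceExponent_eq hq hζm hζ hind (Nat.cast_nonneg _)]
  have := hX.laplaceCumulant_concave (n.cast_nonneg (α := ℝ))
  push_cast
  linarith

theorem lintegral_exp_potentialMeasure_nat (n : ℕ) :
    ∫⁻ y, ENNReal.ofReal (Real.exp (-(n * y))) ∂(potentialMeasure X ζ P) =
      ENNReal.ofReal (laplaceExponent X ζ P n)⁻¹ := by
  rw [hX.lintegral_exp_potentialMeasure hq hζm hζ hind n.cast_nonneg,
    hX.laplaceExponent_eq hq hζm hζ hind n.cast_nonneg]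

/-- The additive functional at the lifetime has the law of `e₁ exp(G) / R`. -/
theorem hasLaw_clock_lifetime {ρ : Measure ℝ} (hρ : IsResidualLaw (laplaceExponent X ζ P) ρ)
    (hρ0 : ρ (Iic 0) = 0) :
    HasLaw (fun ω => clock (realPath X ω) (max (ζ ω) 0)) (factorLaw (gLaw X ζ P) ρ) P := by
  have hzero : ∀ n : ℕ, ∫ ω, discount q n (realPath X ω) (clockInv (realPath X ω) 0) ∂P = 1 := by
    intro n
    simp [(hX.path _).clockInv_zero, discount, (hX.path _).eq_zero 0 le_rfl]
  have hprod : ∀ n, 0 ≤ ∏ k ∈ Finset.range n, laplaceExponent X ζ P k := fun n =>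
    Finset.prod_nonneg fun k _ => (hX.laplaceExponent_pos hq hζm hζ hind k).le
  refine hasLaw_factorLaw_of_potential_chain (hX.laplaceExponent_pos hq hζm hζ hind)
    (hX.lintegral_exp_potentialMeasure_nat hq hζm hζ hind) hρ hρ0
    (hX.laplaceExponent_concave hq hζm hζ hind) (hX.measurable_clock_lifetime hζm).aemeasurable
    (F := fun n t => (∏ k ∈ Finset.range n, laplaceExponent X ζ P k) *
      ∫ ω, discount q n (realPath X ω) (clockInv (realPath X ω) t) ∂P)
    (fun n => continuousOn_const.mul
      (hX.continuousOn_integral_discount_clockInv hq.le n.cast_nonneg))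
    (fun n t ht => ?_) (fun n => by rw [hzero, mul_one]) (fun n t ht => ?_) (fun t ht => ?_)
  · refine ((hX.hasDerivAt_integral_discount_clockInv hq.le n.cast_nonneg ht).const_mul
      (∏ k ∈ Finset.range n, laplaceExponent X ζ P k)).congr_deriv ?_
    rw [Finset.prod_range_succ, hX.laplaceExponent_eq hq hζm hζ hind n.cast_nonneg, Nat.cast_succ]
    ring
  · have h0 := integral_discount_clockInv_nonneg (P := P) (X := X) q n t
    rw [hzero, abs_of_nonneg (mul_nonneg (hprod n) h0)]
    exact mul_le_mul_of_nonneg_left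
      (hX.integral_discount_clockInv_le_one hq.le n.cast_nonneg ht) (hprod n)
  · rw [hX.measure_lt_clock_lifetime hq hζm hζ hind ht]
    simp

end IsRegularSubordinator

theorem expFunctional_eq_clock {Ω : Type*} {X : ℝ≥0 → Ω → ℝ} (ζ : Ω → ℝ) (ω : Ω) :
    expFunctional X ζ ω = clock (realPath X ω) (max (ζ ω) 0) := by
  rw [expFunctional, clock, intervalIntegral.integral_of_le (le_max_right _ _)]
  rcases le_total (ζ ω) 0 with h | h
  · simp [h]
  · rw [max_eq_left h, integral_Ico_eq_integral_Ioc]; rfl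

theorem IsIncreasingPath.integrableOn_exp {g : ℝ → ℝ} (hg : IsIncreasingPath g) (a b : ℝ) :
    IntegrableOn (fun s => Real.exp (g s)) (Ico a b) := by
  rcases le_total b a with h | h
  · simp [h]
  · rw [integrableOn_Ico_iff_integrableOn_Ioo, ← integrableOn_Ioc_iff_integrableOn_Ioo,
      ← intervalIntegrable_iff_integrableOn_Ioc_of_le h]
    exact hg.intervalIntegrable_exp a b

/-- A subordinator has an indistinguishable version all of whose paths are regular. -/
theorem IsSubordinator.exists_regular {Ω : Type*} [MeasurableSpace Ω] {P : Measure Ω}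
    {S : ℝ≥0 → Ω → ℝ} (hS : IsSubordinator S P) :
    ∃ X : ℝ≥0 → Ω → ℝ, IsRegularSubordinator X P ∧ ∀ᵐ ω ∂P, ∀ t, S t ω = X t ω := by
  classical
  have hgood : ∀ᵐ ω ∂P, S 0 ω = 0 ∧ (Monotone fun t => S t ω) ∧
      ∀ t, ContinuousWithinAt (fun s => S s ω) (Ici t) t := by
    filter_upwards [hS.start_zero, hS.monotone_paths, hS.right_continuous] with ω h1 h2 h3
    exact ⟨h1, h2, h3⟩
  -- The set of bad paths need not be measurable, so a measurable null superset is used; there the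
  -- path is replaced by zero.
  set N := toMeasurable P {ω | ¬(S 0 ω = 0 ∧ (Monotone fun t => S t ω) ∧
      ∀ t, ContinuousWithinAt (fun s => S s ω) (Ici t) t)} with hN
  have hN0 : P N = 0 := by rw [hN, measure_toMeasurable]; exact hgood
  have hNm : MeasurableSet N := measurableSet_toMeasurable _ _
  have hmem : ∀ ω, ω ∉ N → S 0 ω = 0 ∧ (Monotone fun t => S t ω) ∧
      ∀ t, ContinuousWithinAt (fun s => S s ω) (Ici t) t := fun ω h => by
    by_contra hc
    exact h (subset_toMeasurable _ _ hc)
  let X : ℝ≥0 → Ω → ℝ := fun t => N.piecewise (fun _ => 0) (S t)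
  have hXS : ∀ᵐ ω ∂P, ∀ t, S t ω = X t ω := by
    have : ∀ᵐ ω ∂P, ω ∉ N := measure_eq_zero_iff_ae_notMem.1 hN0
    filter_upwards [this] with ω h t
    simp [X, h]
  have hXt : ∀ t, S t =ᵐ[P] X t := fun t => hXS.mono fun ω h => h t
  have hXm : ∀ t, Measurable (X t) := fun t => measurable_const.piecewise hNm (hS.measurable t)
  refine ⟨X, ⟨hXm, fun ω => ?_, fun n t ht => ?_, fun s t => ?_⟩, hXS⟩
  · by_cases h : ω ∈ N
    · have h0 : realPath X ω = fun _ => 0 := by ext u; simp [realPath, X, h]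
      rw [h0]
      exact ⟨monotone_const, fun u => continuousWithinAt_const, fun _ _ => rfl⟩
    · obtain ⟨h1, h2, h3⟩ := hmem ω h
      have h0 : realPath X ω = fun u => S u.toNNReal ω := by ext u; simp [realPath, X, h]
      rw [h0]
      refine ⟨fun u v huv => h2 (Real.toNNReal_le_toNNReal huv), fun u => ?_, fun u hu => ?_⟩
      · exact (h3 u.toNNReal).comp (f := Real.toNNReal) (s := Ici u)
          continuous_real_toNNReal.continuousWithinAt
          fun v hv => Real.toNNReal_le_toNNReal hv
      · rw [Real.toNNReal_of_nonpos hu, h1]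
  · exact (hS.indep_increments n t ht).congr fun i => (hXt _).sub (hXt _)
  · have h1 : (fun ω => S (s + t) ω - S s ω) =ᵐ[P] fun ω => X (s + t) ω - X s ω :=
      (hXt _).sub (hXt _)
    exact ((IdentDistrib.of_ae_eq ((hS.measurable _).sub (hS.measurable _)).aemeasurable
      h1).symm.trans (hS.stationary_increments s t)).trans
      (IdentDistrib.of_ae_eq (hS.measurable t).aemeasurable (hXt t))

section congr
variable {Ω : Type*} [MeasurableSpace Ω] {P : Measure Ω} {S X : ℝ≥0 → Ω → ℝ}
  (h : ∀ᵐ ω ∂P, ∀ t, S t ω = X t ω) (ζ : Ω → ℝ)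
include h

theorem laplaceExponent_congr : laplaceExponent S ζ P = laplaceExponent X ζ P := by
  ext l
  rw [laplaceExponent, laplaceExponent]
  congr 2
  refine integral_congr_ae (ae_restrict_of_ae ?_)
  filter_upwards [h] with ω hω
  rw [hω]

theorem potentialMeasure_congr : potentialMeasure S ζ P = potentialMeasure X ζ P := by
  refine Measure.map_congr (ae_restrict_of_ae ?_)
  filter_upwards [Measure.quasiMeasurePreserving_fst.ae h] with p hp
  exact hp _

theorem gLaw_congr : gLaw S ζ P = gLaw X ζ P := by
  rw [gLaw, gLaw, laplaceExponent_congr h, potentialMeasure_congr h]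

theorem expFunctional_ae_eq : expFunctional S ζ =ᵐ[P] expFunctional X ζ := by
  filter_upwards [h] with ω hω
  simp only [expFunctional, hω]

end congr

theorem proposition1 {Ω : Type*} [MeasurableSpace Ω] (P : Measure Ω) [IsProbabilityMeasure P]
    (S : ℝ≥0 → Ω → ℝ) (ζ : Ω → ℝ) (q : ℝ) (hσ : IsKilledSubordinator S ζ q P) :
    IsProbabilityMeasure (gLaw S ζ P) ∧
    ∃ ρ : Measure ℝ,
      -- `ρ` is the law of `R_σ`: it exists, is unique, and does not charge `0`
      (∀ ρ' : Measure ℝ, IsResidualLaw (laplaceExponent S ζ P) ρ' ↔ ρ' = ρ) ∧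
      ρ (Iic 0) = 0 ∧
      -- every solution `W` of the equation has the law of `e₁ exp(G⁽⁰⁾) / R_σ`
      (∀ {Ω' : Type*} [MeasurableSpace Ω'] (P' : Measure Ω') [IsProbabilityMeasure P']
        (W : Ω' → ℝ) (h : ℝ → ℝ),
        IsCompletelyMonotone h →
        HasLaw W ((volume.restrict (Ioi 0)).withDensity fun u => ENNReal.ofReal (h u)) P' →
        (∀ t : ℝ, 0 < t → P' {ω | t < W ω} =
          ∫⁻ a, ENNReal.ofReal (h (t * Real.exp (-a))) ∂(potentialMeasure S ζ P)) →
        HasLaw W (factorLaw (gLaw S ζ P) ρ) P') ∧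
      -- the exponential functional is finite and has the same law
      (∀ᵐ ω ∂P, IntegrableOn (fun s : ℝ => Real.exp (S s.toNNReal ω)) (Ico 0 (ζ ω))) ∧
      HasLaw (expFunctional S ζ) (factorLaw (gLaw S ζ P) ρ) P := by
  obtain ⟨X, hX, hSX⟩ := hσ.isSubordinator.exists_regular
  have hq := hσ.rate_pos
  have hζm := hσ.lifetime_measurable
  have hζ := hσ.lifetime_law
  have hind : IndepFun (fun ω t => X t ω) ζ P :=
    hσ.lifetime_indep.congr (hSX.mono fun ω h => funext h) EventuallyEq.rfl
  rw [laplaceExponent_congr hSX, gLaw_congr hSX, potentialMeasure_congr hSX]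
  have hpos := hX.laplaceExponent_pos hq hζm hζ hind
  have hV := hX.lintegral_exp_potentialMeasure_nat hq hζm hζ hind
  have hmono := hX.laplaceExponent_monotone hq hζm hζ hind
  have hconc := hX.laplaceExponent_concave hq hζm hζ hind
  obtain ⟨ρ, hρ, hρ0⟩ := exists_residualLaw hpos hV hmono
    (tendsto_ratio_of_concave (φ := fun n : ℕ => laplaceExponent X ζ P n) hpos hmono hconc)
  refine ⟨isProbabilityMeasure_smul_potential hpos hV, ρ,
    fun ρ' => ⟨fun h => h.eq hρ hpos hconc, fun h => h ▸ hρ⟩, hρ0,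
    fun P' _ W h hh hW heq =>
      hasLaw_factorLaw_of_completelyMonotone hpos hV hρ hρ0 hconc hh hW heq, ?_, ?_⟩
  · filter_upwards [hSX] with ω hω
    simp only [hω]
    exact (hX.path ω).integrableOn_exp 0 (ζ ω)
  · refine HasLaw.congr ?_ (expFunctional_ae_eq hSX ζ)
    simpa only [← expFunctional_eq_clock] using hX.hasLaw_clock_lifetime hq hζm hζ hind hρ hρ0
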